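/- **Conventions.** All graphs are simple graphs, viewed as simplicial complexes of dimension at most one. A *coloring* of a graph assigns a natural number to each simplex (vertex or edge); a *colored embedding* is an injective simplicial map that preserves the colors of all simplices. A map $K\to L$ of graphs is *quasi-simplicial* if it is a simplicial map from $K$ into the barycentric subdivision $\beta L$. A *production* is a simplicial or quasi-simplicial map $P\colon t(P)\to b(P)$ from a colored graph $t(P)$ (its *top*) to a colored graph $b(P)$ (its *bottom*). A *gluing* of a production $S$ to a production $T$ is a pair of colored embeddings $G_t\colon t(S)\to t(T)$, $G_b\colon b(S)\to b(T)$ with $T\circ G_t=G_b\circ S$. A *Markov diagram* $\mathcal D=(S,\mathcal P,\mathcal G)$ consists of a starting complex $S$, a set $\mathcal P$ of productions and a set $\mathcal G$ of gluings. It is *elementary* if the bottom of every production in $\mathcal P$ is a single vertex (*vertex production*) or a single edge (*edge production*). An *assembly graph* for $\mathcal D$ is a directed graph $\Gamma=(V,E)$ whose vertices $v$ are labelled by productions $P(v)\in\mathcal P$ and whose edges $e=(u,v)$ are labelled by gluings $G(e)\in\mathcal G$ of $P(u)$ to $P(v)$. A *decomposition* over $\mathcal D$ of a simplicial or quasi-simplicial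 map $f\colon K\to L$ of colored graphs consists of an assembly graph $\Gamma$ and colored embeddings $f_v\colon t(P(v))\to K$, $g_v\colon b(P(v))\to L$ ($v\in V$) such that * $f\circ f_v=g_v\circ P(v)$ for all $v\in V$, and $f_v\circ G(e)_t=f_u$, $g_v\circ G(e)_b=g_u$ for every edge $e=(u,v)$; * $\{\operatorname{im} f_v\}_{v\in V}$ covers $K$ and $\{\operatorname{im} g_v\}_{v\in V}$ covers $L$; * the two covers are compatibly closed under nonempty intersections: if $\operatorname{im} g_u\cap\operatorname{im} g_v\neq\emptyset$, then there is $w\in V$ with $\operatorname{im} f_w=\operatorname{im} f_u\cap\operatorname{im} f_v$ and $\operatorname{im} g_w=\operatorname{im} g_u\cap\operatorname{im} g_v$. A compact (metrizable) space $X$ has the *disjoint arcs property* if for every map $f\colon[0,1]\times\{0,1\}\to X$ and every $\varepsilon>0$ there is a map $f'\colon[0,1]\times\{0,1\}\to X$ that is $\varepsilon$-close to $f$ and satisfies $f'([0,1]\times\{0\})\cap f'([0,1]\times\{1\})=\emptyset$ (maps are continuous). A graph is *biconnected* if it has at least three vertices and remains connected after the deletion of any one vertex. **Theorem.** Let $X$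 be the inverse limit of a sequence $$K_1\xleftarrow{p_1}K_2\xleftarrow{p_2}K_3\xleftarrow{p_3}\cdots$$ of finite colored graphs, each of whose bonding maps $p_i$ is equipped with a decomposition over an elementary Markov diagram $\mathcal D$. Suppose that the top graph of each vertex production of $\mathcal D$ is a single edge (so that the production maps a single edge onto a point), and that each edge production of $\mathcal D$ is quasi-simplicial and has a connected and biconnected top graph. Then $X$ is compact and has the disjoint arcs property. -/

import Mathlib

open scoped Uniformity

universe u v

namespace Markov

/-! ### Graphs as one-dimensional simplicial complexes -/

/-- A graph with a colouring of its simplices (its vertices and its edges) by natural numbers. -/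
structure ColoredGraph where
  V : Type u
  graph : SimpleGraph V
  vertexColor : V → ℕ
  edgeColor : graph.edgeSet → ℕ

/-- The finite set `s` spans a simplex of the graph `G`: it is a vertex or the pair of end points
of an edge. -/
def IsSimplex {V : Type u} (G : SimpleGraph V) (s : Finset V) : Prop :=
  s.Nonempty ∧ s.card ≤ 2 ∧ ∀ a ∈ s, ∀ b ∈ s, a ≠ b → G.Adj a b

/-- A coloured embedding: an injective simplicial map that preserves the colours of all
vertices and edges. -/
structure ColoredEmbedding (K L : ColoredGraph.{u}) where
  toCopy : SimpleGraph.Copy K.graph L.graph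
  vertexColor_eq : ∀ x, L.vertexColor (toCopy x) = K.vertexColor x
  edgeColor_eq : ∀ e : K.graph.edgeSet,
    L.edgeColor (toCopy.toHom.mapEdgeSet e) = K.edgeColor e

/-- The image of a coloured embedding, a subcomplex of the target. -/
def ColoredEmbedding.image {K L : ColoredGraph.{u}} (i : ColoredEmbedding K L) :
    L.graph.Subgraph :=
  i.toCopy.toSubgraph

/-- A vertex map `φ`, sending a vertex `x` of `K` to the barycentre of the simplex `φ x` of `L`, is
simplicial (as a map from `K` to `L`) if it sends vertices to vertices, and end points of an edge to
equal or adjacent vertices. -/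
def IsSimplicialVertexMap (K L : ColoredGraph.{u}) (φ : K.V → Finset L.V) : Prop :=
  ∃ ψ : K.V → L.V, (∀ x, φ x = {ψ x}) ∧
    ∀ x y, K.graph.Adj x y → ψ x = ψ y ∨ L.graph.Adj (ψ x) (ψ y)

/-- A vertex map `φ`, sending a vertex `x` of `K` to the barycentre of the simplex `φ x` of `L`, is
quasi-simplicial if it is a simplicial map from `K` to the barycentric subdivision of `L`.
The vertices of the subdivision are the simplices of `L`, and its simplices are the chains of
simplices of `L`. -/
def IsQuasiSimplicialVertexMap (K L : ColoredGraph.{u}) (φ : K.V → Finset L.V) : Prop :=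
  (∀ x, IsSimplex L.graph (φ x)) ∧ ∀ x y, K.graph.Adj x y → φ x ⊆ φ y ∨ φ y ⊆ φ x

/-- A simplicial or quasi-simplicial map `K → L`, given by its values at the vertices of `K`, which
are barycentres of simplices of `L`. -/
structure GraphMap (K L : ColoredGraph.{u}) where
  toFun : K.V → Finset L.V
  simplicial_or_quasiSimplicial :
    IsSimplicialVertexMap K L toFun ∨ IsQuasiSimplicialVertexMap K L toFun

def GraphMap.IsQuasiSimplicial {K L : ColoredGraph.{u}} (f : GraphMap K L) : Prop :=
  IsQuasiSimplicialVertexMap K L f.toFun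

/-! ### Geometric realization -/

/-- The barycentre of the simplex `s`, in barycentric coordinates. -/
noncomputable def barycenter {V : Type u} (s : Finset V) : V → ℝ :=
  (s : Set V).indicator fun _ => (s.card : ℝ)⁻¹

/-- The geometric realization of a finite graph, in barycentric coordinates. -/
def realization {V : Type u} [Fintype V] (G : SimpleGraph V) : Set (V → ℝ) :=
  {t | (∀ x, 0 ≤ t x) ∧ ∑ x, t x = 1 ∧ ∃ s, IsSimplex G s ∧ ∀ x, x ∉ s → t x = 0}

/-- The map between the geometric realizations: affine on each simplex of `K`, with the prescribed
values at the vertices. -/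
noncomputable def GraphMap.realize {K L : ColoredGraph.{u}} [Fintype K.V] (f : GraphMap K L)
    (t : K.V → ℝ) : L.V → ℝ :=
  ∑ x, t x • barycenter (f.toFun x)

/-! ### Markov diagrams -/

/-- A production: a simplicial or quasi-simplicial map from the top to the bottom. -/
structure Production where
  top : ColoredGraph.{u}
  bottom : ColoredGraph.{u}
  map : GraphMap top bottom

/-- A gluing of productions: a commutative square of coloured embeddings. -/
structure Gluing (S T : Production.{u}) where
  top : ColoredEmbedding S.top T.top
  bottom : ColoredEmbedding S.bottom T.bottom
  comm : ∀ x, T.map.toFun (top.toCopy x) = (S.map.toFun x).map bottom.toCopy.toEmbedding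

/-- A Markov diagram: a starting complex, a set of productions and a set of gluing rules. -/
structure MarkovDiagram where
  start : ColoredGraph.{u}
  productions : Set Production.{u}
  gluings : ∀ S T : Production.{u}, Set (Gluing S T)

/-- An assembly graph: a directed graph whose vertices are labelled by productions and whose edges
are labelled by gluing rules. -/
structure AssemblyGraph (D : MarkovDiagram.{u}) where
  Vert : Type v
  Edge : Type v
  src : Edge → Vert
  tgt : Edge → Vert
  prod : Vert → Production.{u}
  prod_mem : ∀ a, prod a ∈ D.productions
  glue : ∀ e, Gluing (prod (src e)) (prod (tgt e))
  glue_mem : ∀ e, glue e ∈ D.gluings (prod (src e)) (prod (tgt e))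

/-- A decomposition of `f : K → L` with respect to the diagram `D`: an assembly graph together with
a top chart and a bottom chart. The images of the charts cover `K` and `L`, and the two covers are
closed under (nonempty) intersections, compatibly with each other. -/
structure Decomposition (D : MarkovDiagram.{u}) {K L : ColoredGraph.{u}} (f : GraphMap K L) where
  Γ : AssemblyGraph.{u, v} D
  topChart : ∀ a, ColoredEmbedding (Γ.prod a).top K
  bottomChart : ∀ a, ColoredEmbedding (Γ.prod a).bottom L
  comm : ∀ a x, f.toFun ((topChart a).toCopy x) =
    ((Γ.prod a).map.toFun x).map (bottomChart a).toCopy.toEmbedding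
  top_glue : ∀ e x,
    (topChart (Γ.tgt e)).toCopy ((Γ.glue e).top.toCopy x) = (topChart (Γ.src e)).toCopy x
  bottom_glue : ∀ e x,
    (bottomChart (Γ.tgt e)).toCopy ((Γ.glue e).bottom.toCopy x) = (bottomChart (Γ.src e)).toCopy x
  top_cover : ⨆ a, (topChart a).image = ⊤
  bottom_cover : ⨆ a, (bottomChart a).image = ⊤
  inter_closed : ∀ a b, (bottomChart a).image ⊓ (bottomChart b).image ≠ ⊥ →
    ∃ c, (topChart c).image = (topChart a).image ⊓ (topChart b).image ∧
      (bottomChart c).image = (bottomChart a).image ⊓ (bottomChart b).image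

/-- A Markov sequence: an inverse sequence with decompositions of all bonding maps over `D`. -/
structure MarkovSequence (D : MarkovDiagram.{u}) where
  K : ℕ → ColoredGraph.{u}
  p : ∀ i, GraphMap (K (i + 1)) (K i)
  decomposition : ∀ i, Decomposition.{u, v} D (p i)

/-- The limit of a Markov sequence of finite graphs, as a subspace of the product
of the geometric realizations. -/
def MarkovSequence.Limit {D : MarkovDiagram.{u}} (S : MarkovSequence.{u, v} D)
    [∀ i, Fintype (S.K i).V] : Type u :=
  {x : ∀ i, (S.K i).V → ℝ // (∀ i, x i ∈ realization (S.K i).graph) ∧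
    ∀ i, (S.p i).realize (x (i + 1)) = x i}

instance MarkovSequence.instUniformSpaceLimit {D : MarkovDiagram.{u}} (S : MarkovSequence.{u, v} D)
    [∀ i, Fintype (S.K i).V] : UniformSpace S.Limit :=
  inferInstanceAs (UniformSpace {x : ∀ i, (S.K i).V → ℝ //
    (∀ i, x i ∈ realization (S.K i).graph) ∧ ∀ i, (S.p i).realize (x (i + 1)) = x i})

/-! ### Hypotheses and conclusion -/

/-- A single vertex graph. -/
def IsSingleVertex {V : Type u} (G : SimpleGraph V) : Prop :=
  Nonempty (G ≃g (⊤ : SimpleGraph (Fin 1)))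

/-- A single edge graph. -/
def IsSingleEdge {V : Type u} (G : SimpleGraph V) : Prop :=
  Nonempty (G ≃g (⊤ : SimpleGraph (Fin 2)))

/-- All bottom graphs of productions are single vertex graphs or single edge graphs. -/
def MarkovDiagram.IsElementary (D : MarkovDiagram.{u}) : Prop :=
  ∀ P ∈ D.productions, IsSingleVertex P.bottom.graph ∨ IsSingleEdge P.bottom.graph

/-- A vertex production is a production whose bottom is a single vertex. -/
def Production.IsVertexProduction (P : Production.{u}) : Prop :=
  IsSingleVertex P.bottom.graph

/-- An edge production is a production whose bottom is a single edge. -/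
def Production.IsEdgeProduction (P : Production.{u}) : Prop :=
  IsSingleEdge P.bottom.graph

/-- A biconnected (2-connected) graph: at least three vertices, and no deletion of a
vertex disconnects it. -/
def IsBiconnected {V : Type u} (G : SimpleGraph V) : Prop :=
  2 < ENat.card V ∧ ∀ x : V, (G.induce {x}ᶜ).Connected

/-- The disjoint arcs property. A compact Hausdorff space has only one compatible uniformity; for a
compact metric space, "`U`-close for each entourage `U`" is "`ε`-close for each `ε > 0`". -/
def DisjointArcsProperty (X : Type u) [UniformSpace X] : Prop :=
  CompactSpace X ∧ ∀ f : C(unitInterval × Bool, X), ∀ U ∈ 𝓤 X,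
    ∃ f' : C(unitInterval × Bool, X), (∀ z, (f z, f' z) ∈ U) ∧
      Disjoint (Set.range fun s : unitInterval => f' (s, false))
        (Set.range fun s : unitInterval => f' (s, true))

end Markov

/-! Idea of the proof. From the third graph on, every vertex has two neighbours, and each bonding
map between such graphs is a blow-up (`Decomposition.nonempty_blowup`). Over a vertex `v` lies an
edge with ends `a v`, `b v`. Over an edge `vw` lies a biconnected part containing the edges over `v`
and `w`, and parts over distinct simplices meet only over a common vertex.

Biconnectedness joins the edges over `v` and `w` by two disjoint walks (`linked_of_biconnected`),
but which end is joined to which cannot be prescribed. Lifting the realization of a stage along `a`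
and along `b` therefore gives two maps to the next stage that may still have to cross, but only over
vertices (`Blowup.exists_isCarrier_inter_subset`). One more blow-up removes the crossings. The edges
of the intermediate graph whose ends both lie on the two lifts form a matching, because an edge
between vertices over vertices has both ends over the same vertex. So the names of the two vertices
over each vertex can be chosen to make the linkage over every matching edge straight. Over any other
edge at most one end is shared, and deleting one vertex over it keeps the part connected
(`Blowup.exists_isCarrier_disjoint`).

Hence arbitrary maps into the limit, projected to a late stage, have approximate lifts with disjoint
supports two stages later. Further lifts are chosen freely. Quasi-simplicial maps contract each
simplex by `1 / 2`, so the lifts converge uniformly (`MarkovSequence.exists_limit_map`). The limit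
maps keep their supports inside those of the lifts, which gives disjointness at the stage of the
disjoint lifts, and closeness to the original maps at the starting stage. -/

namespace Markov

/-! ### Joining vertices inside a set, and two disjoint paths -/

/-- The vertices `x` and `y` are joined by a walk inside `W`. -/
def Joins {V : Type*} (G : SimpleGraph V) (W : Set V) (x y : V) : Prop :=
  ∃ p : G.Walk x y, ∀ z ∈ p.support, z ∈ W

namespace Joins

variable {V V' : Type*} {G : SimpleGraph V} {H : SimpleGraph V'} {W W' : Set V} {x y z : V}

theorem refl (hx : x ∈ W) : Joins G W x x := ⟨.nil, by simpa using hx⟩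

theorem symm (h : Joins G W x y) : Joins G W y x := by
  obtain ⟨p, hp⟩ := h
  exact ⟨p.reverse, by simpa using hp⟩

theorem trans (h : Joins G W x y) (h' : Joins G W y z) : Joins G W x z := by
  obtain ⟨p, hp⟩ := h
  obtain ⟨q, hq⟩ := h'
  refine ⟨p.append q, fun u hu => ?_⟩
  rw [SimpleGraph.Walk.mem_support_append_iff] at hu
  exact hu.elim (hp u) (hq u)

theorem mono (h : Joins G W x y) (hW : W ⊆ W') : Joins G W' x y := by
  obtain ⟨p, hp⟩ := h
  exact ⟨p, fun z hz => hW (hp z hz)⟩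

theorem of_adj (h : G.Adj x y) (hx : x ∈ W) (hy : y ∈ W) : Joins G W x y :=
  ⟨h.toWalk, by simp [hx, hy]⟩

theorem map (h : Joins G W x y) (f : G →g H) : Joins H (f '' W) (f x) (f y) := by
  obtain ⟨p, hp⟩ := h
  refine ⟨p.map f, fun z hz => ?_⟩
  rw [SimpleGraph.Walk.support_map, List.mem_map] at hz
  obtain ⟨u, hu, rfl⟩ := hz
  exact ⟨u, hp u hu, rfl⟩

theorem left_mem (h : Joins G W x y) : x ∈ W := by
  obtain ⟨p, hp⟩ := h
  exact hp _ p.start_mem_support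

theorem right_mem (h : Joins G W x y) : y ∈ W := h.symm.left_mem

/-- A walk that reaches a set `S` has an initial part that meets `S` in its end point only. -/
theorem exists_first_hit {S : Set V} (h : Joins G W x y) (hy : y ∈ S) :
    ∃ u ∈ S, ∃ R ⊆ W, Joins G R x u ∧ ∀ z ∈ R, z ∈ S → z = u := by
  obtain ⟨p, hp⟩ := h
  induction p with
  | nil =>
    refine ⟨_, hy, {_}, ?_, refl rfl, fun z hz _ => hz⟩
    simpa using hp
  | @cons x m y hadj p ih =>
    by_cases hx : x ∈ S
    · refine ⟨x, hx, {x}, ?_, refl rfl, fun z hz _ => hz⟩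
      simpa using hp x (by simp)
    · obtain ⟨u, hu, R, hR, hj, hz⟩ := ih hy fun z hz => hp z (by simp [hz])
      refine ⟨u, hu, insert x R, ?_, ?_, ?_⟩
      · rintro z (rfl | hz)
        · exact hp _ (by simp)
        · exact hR hz
      · exact (of_adj hadj (by simp) (by simp [hj.left_mem])).trans (hj.mono (by simp))
      · rintro z (rfl | hz') hzS
        · exact absurd hzS hx
        · exact hz z hz' hzS

/-- A walk can be cut off at any of its vertices. -/
theorem exists_cut (h : Joins G W x y) :
    ∃ P ⊆ W, Joins G P x y ∧ ∀ u ∈ P, ∃ Q ⊆ P, Joins G Q x u ∧ (u ≠ y → y ∉ Q) := by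
  classical
  obtain ⟨p, hp⟩ := h
  refine ⟨{z | z ∈ p.bypass.support}, fun z hz => hp z (p.support_bypass_subset_support hz),
    ⟨p.bypass, fun z hz => hz⟩, fun u hu => ?_⟩
  refine ⟨{z | z ∈ (p.bypass.takeUntil u hu).support},
    fun z hz => SimpleGraph.Walk.support_takeUntil_subset_support _ hu hz,
    ⟨_, fun z hz => hz⟩, fun hne => ?_⟩
  exact SimpleGraph.Walk.endpoint_notMem_support_takeUntil p.bypass_isPath hu hne.symm

end Joins

/-! ### Two disjoint walks between edges of a biconnected graph. -/

section TwoPaths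

variable {V : Type*} {G : SimpleGraph V}

/-- The pairs `{a, b}` and `{c, d}` are joined by two disjoint walks. -/
def Linked (G : SimpleGraph V) (a b c d : V) : Prop :=
  ∃ P Q : Set V, Disjoint P Q ∧
    ((Joins G P a c ∧ Joins G Q b d) ∨ (Joins G P a d ∧ Joins G Q b c))

theorem Linked.symm_left {a b c d : V} (h : Linked G a b c d) : Linked G b a c d := by
  obtain ⟨P, Q, hd, h | h⟩ := h
  exacts [⟨Q, P, hd.symm, .inr h.symm⟩, ⟨Q, P, hd.symm, .inl h.symm⟩]

theorem joins_compl_of_biconnected (hG : IsBiconnected G) {x y z : V} (hx : x ≠ z) (hy : y ≠ z) :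
    Joins G {z}ᶜ x y := by
  obtain ⟨p⟩ := (hG.2 z).preconnected ⟨x, hx⟩ ⟨y, hy⟩
  have h : Joins (G.induce {z}ᶜ) Set.univ ⟨x, hx⟩ ⟨y, hy⟩ := ⟨p, fun _ _ => trivial⟩
  refine (Joins.map h (SimpleGraph.Embedding.induce {z}ᶜ).toHom).mono ?_
  rintro _ ⟨w, -, rfl⟩
  exact w.2

/-- Follow a walk from `z` to `c` that avoids `d` until it first hits one of the two given walks. If
it hits the walk to `c`, reroute that one to `z` and leave the other ending at `d`. If it hits the
walk to `d`, reroute it to `z` before it reaches `d`, and extend the walk to `c` by the edge `cd`.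
-/
theorem Linked.step_of_parallel (hG : IsBiconnected G) {a b c d z : V} {P Q : Set V}
    (hPQ : Disjoint P Q) (hP : Joins G P a c) (hQ : Joins G Q b d) (hcd : G.Adj c d)
    (hdz : G.Adj d z) : Linked G a b d z := by
  obtain ⟨P, hPs, hP, hPc⟩ := hP.exists_cut
  obtain ⟨Q, hQs, hQ, hQc⟩ := hQ.exists_cut
  replace hPQ := hPQ.mono hPs hQs
  have hcP := hP.right_mem
  have hdQ := hQ.right_mem
  have hdP : d ∉ P := fun h => Set.disjoint_left.1 hPQ h hdQ
  obtain ⟨u, hu, R, hR, hzu, hRu⟩ :=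
    (joins_compl_of_biconnected hG hdz.ne' hcd.ne).exists_first_hit (S := P ∪ Q) (.inl hcP)
  have hud : u ≠ d := hR hzu.right_mem
  have hdR : d ∉ R := fun h => hR h rfl
  rcases hu with hu | hu
  · obtain ⟨P', hP', haP', -⟩ := hPc u hu
    refine ⟨P' ∪ R, Q, ?_, .inr ⟨(haP'.mono (by simp)).trans (hzu.symm.mono (by simp)), hQ⟩⟩
    rw [Set.disjoint_left]
    rintro x (hx | hx) hxQ
    · exact Set.disjoint_left.1 hPQ (hP' hx) hxQ
    · have := hRu x hx (.inr hxQ)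
      subst this
      exact Set.disjoint_left.1 hPQ hu hxQ
  · obtain ⟨Q', hQ', hbQ', hdQ'⟩ := hQc u hu
    refine ⟨insert d P, Q' ∪ R, ?_, .inl ⟨(hP.mono (by simp)).trans
      (.of_adj hcd (by simp [hcP]) (by simp)), (hbQ'.mono (by simp)).trans
        (hzu.symm.mono (by simp))⟩⟩
    rw [Set.disjoint_left]
    rintro x (rfl | hx) (hx' | hx')
    · exact hdQ' hud hx'
    · exact hdR hx'
    · exact Set.disjoint_left.1 hPQ hx (hQ' hx')
    · have := hRu x hx' (.inl hx)
      subst this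
      exact Set.disjoint_left.1 hPQ hx hu

theorem Linked.step (hG : IsBiconnected G) {a b c d z : V} (h : Linked G a b c d)
    (hcd : G.Adj c d) (hdz : G.Adj d z) : Linked G a b d z := by
  obtain ⟨P, Q, hd, ⟨h, h'⟩ | ⟨h, h'⟩⟩ := h
  · exact step_of_parallel hG hd h h' hcd hdz
  · exact (step_of_parallel hG hd.symm h' h hcd hdz).symm_left

/-- The target edge slides along the walk; its last edge is only known to end at `z`, hence the
existential `y`. -/
theorem Linked.along_walk (hG : IsBiconnected G) {a b d z : V} (p : G.Walk d z) :
    ∀ c, Linked G a b c d → G.Adj c d → ∃ y, Linked G a b y z ∧ G.Adj y z := by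
  induction p with
  | nil => exact fun c h h' => ⟨c, h, h'⟩
  | cons hadj p ih => exact fun c h h' => ih _ (h.step hG h' hadj) hadj

/-- In a biconnected graph, the end points of any two edges are joined by two disjoint walks. -/
theorem linked_of_biconnected (hG : IsBiconnected G) (hc : G.Connected) {a b c d : V}
    (hab : G.Adj a b) (hcd : G.Adj c d) : Linked G a b c d := by
  -- The edge `ab` is linked to itself by constant walks; this target edge is then slid along a walk
  -- from `b` to `c`, and finally onto `cd`.
  have h₀ : Linked G a b a b := by
    refine ⟨{a}, {b}, by simpa using hab.ne, .inl ⟨.refl rfl, .refl rfl⟩⟩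
  obtain ⟨p⟩ := hc.preconnected b c
  obtain ⟨y, h, hy⟩ := h₀.along_walk hG p a hab
  exact h.step hG hy hcd

/-- Connectedness gives one neighbour `y`. Deleting `y` leaves a connected graph that still contains
a vertex other than `x`, so `x` has a neighbour there too. -/
theorem exists_two_neighbors_of_biconnected (hG : IsBiconnected G) (hc : G.Connected) (x : V) :
    ∃ y z, G.Adj x y ∧ G.Adj x z ∧ y ≠ z := by
  have hcard := hG.1
  have key : ∀ T : Set V, x ∈ T → (G.induce T).Connected → (∃ w ∈ T, w ≠ x) →
      ∃ y ∈ T, G.Adj x y := by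
    rintro T hx hT ⟨w, hw, hne⟩
    obtain ⟨p⟩ := hT.preconnected ⟨x, hx⟩ ⟨w, hw⟩
    cases p with
    | nil => exact absurd rfl hne
    | cons h p => exact ⟨_, Subtype.prop _, h⟩
  have hex : ∀ y, ∃ w, w ≠ x ∧ w ≠ y := by
    intro y
    by_contra! h
    have hsub : (Set.univ : Set V) ⊆ {x, y} := fun w _ => by
      by_cases hw : w = x
      · exact .inl hw
      · exact .inr (h w hw)
    have h1 := Set.encard_le_encard hsub
    have h2 : ({x, y} : Set V).encard ≤ 2 := (Set.encard_insert_le _ _).trans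
      (by simp [one_add_one_eq_two])
    rw [Set.encard_univ] at h1
    exact absurd (hcard.trans_le (h1.trans h2)) (lt_irrefl _)
  obtain ⟨w, hw, -⟩ := hex x
  obtain ⟨p⟩ := hc.preconnected x w
  obtain ⟨y, hy⟩ : ∃ y, G.Adj x y := by
    cases p with
    | nil => exact absurd rfl hw
    | cons h p => exact ⟨_, h⟩
  obtain ⟨w', hw', hw'y⟩ := hex y
  obtain ⟨z, hz, hxz⟩ := key {y}ᶜ hy.ne (hG.2 y) ⟨w', hw'y, hw'⟩
  exact ⟨y, z, hy, hxz, fun h => hz h.symm⟩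

end TwoPaths

/-! ### Blow-ups of graphs -/

/-- A blow-up of `G`: over each vertex of `G` there is an edge of `H`, over each edge of `G` a part
of `H` in which edges are joined by two disjoint walks and which no vertex separates. The vertex map
`φ` describes the projection from `H` to `G`. -/
structure Blowup {V V' : Type*} [DecidableEq V] (G : SimpleGraph V) (H : SimpleGraph V')
    (φ : V' → Finset V) where
  part : Finset V → Set V'
  a : V → V'
  b : V → V'
  adj : ∀ v, H.Adj (a v) (b v)
  part_singleton : ∀ v, part {v} = {a v, b v}
  map_of_mem_singleton : ∀ v, ∀ x ∈ part {v}, φ x = {v}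
  map_subset : ∀ s, IsSimplex G s → ∀ x ∈ part s, φ x ⊆ s
  part_mono : ∀ s, IsSimplex G s → ∀ v ∈ s, part {v} ⊆ part s
  mem_inter : ∀ s t, IsSimplex G s → IsSimplex G t → s ≠ t → ∀ x ∈ part s, x ∈ part t →
    ∃ v ∈ s, v ∈ t ∧ x ∈ part {v}
  linked : ∀ v w, G.Adj v w → ∃ P ⊆ part {v, w}, ∃ Q ⊆ part {v, w},
    Disjoint P Q ∧ ((Joins H P (a v) (a w) ∧ Joins H Q (b v) (b w)) ∨
      (Joins H P (a v) (b w) ∧ Joins H Q (b v) (a w)))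
  joins_avoiding : ∀ v w, G.Adj v w → ∀ z, ∀ x ∈ part {v, w},
    ∀ y ∈ part {v, w}, x ≠ z → y ≠ z → Joins H (part {v, w} \ {z}) x y
  quasi : ∀ x y, H.Adj x y → φ x ⊆ φ y ∨ φ y ⊆ φ x

/-! ### Carriers and their intersections. -/

section Carriers

variable {V V' V'' : Type*} {G : SimpleGraph V}
  {H : SimpleGraph V'} {J : SimpleGraph V''} {φ : V' → Finset V} {ψ : V'' → Finset V'}

theorem isSimplex_singleton (v : V) : IsSimplex G {v} := by
  simp [IsSimplex]

variable [DecidableEq V]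

theorem isSimplex_pair {v w : V} (h : G.Adj v w) : IsSimplex G {v, w} := by
  refine ⟨by simp, Finset.card_le_two, ?_⟩
  simp [h, h.symm]

theorem IsSimplex.eq_singleton_or_pair {s : Finset V} (h : IsSimplex G s) :
    (∃ v, s = {v}) ∨ ∃ v w, G.Adj v w ∧ s = {v, w} := by
  obtain ⟨h₀, h₂, hadj⟩ := h
  have := h₀.card_pos
  obtain h | h : s.card = 1 ∨ s.card = 2 := by omega
  · exact .inl (Finset.card_eq_one.1 h)
  · obtain ⟨v, w, hne, rfl⟩ := Finset.card_eq_two.1 h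
    exact .inr ⟨v, w, hadj v (by simp) w (by simp) hne, rfl⟩

/-- A carrier: it assigns to each simplex of `G` a set of vertices of `H` over it, in which the
chosen vertices over the vertices of the simplex are joined. -/
structure IsCarrier (G : SimpleGraph V) (H : SimpleGraph V') (φ : V' → Finset V) (μ : V → V')
    (W : Finset V → Set V') : Prop where
  mem : ∀ v, μ v ∈ W {v}
  joins : ∀ v w, G.Adj v w → Joins H (W {v, w}) (μ v) (μ w)
  map_subset : ∀ s, IsSimplex G s → ∀ x ∈ W s, φ x ⊆ s

/-- Two vertex choices with carriers can be put together simplex by simplex. -/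
theorem exists_isCarrier_pair {μ ν : V → V'} {R : Finset V → Set V' → Set V' → Prop}
    (hv : ∀ v, R {v} {μ v} {ν v})
    (hμ : ∀ v, φ (μ v) = {v}) (hν : ∀ v, φ (ν v) = {v})
    (he : ∀ v w, G.Adj v w → ∃ P Q, Joins H P (μ v) (μ w) ∧ Joins H Q (ν v) (ν w) ∧
      (∀ x ∈ P, φ x ⊆ {v, w}) ∧ (∀ x ∈ Q, φ x ⊆ {v, w}) ∧ R {v, w} P Q) :
    ∃ W W', IsCarrier G H φ μ W ∧ IsCarrier G H φ ν W' ∧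
      ∀ s, IsSimplex G s → R s (W s) (W' s) := by
  have key : ∀ s, ∃ P Q, IsSimplex G s → (∀ v, s = {v} → μ v ∈ P ∧ ν v ∈ Q) ∧
      (∀ v w, G.Adj v w → s = {v, w} → Joins H P (μ v) (μ w) ∧ Joins H Q (ν v) (ν w)) ∧
      (∀ x ∈ P, φ x ⊆ s) ∧ (∀ x ∈ Q, φ x ⊆ s) ∧ R s P Q := by
    intro s
    by_cases hs : IsSimplex G s
    swap
    · exact ⟨∅, ∅, fun h => absurd h hs⟩
    obtain ⟨v, rfl⟩ | ⟨v, w, h, rfl⟩ := hs.eq_singleton_or_pair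
    · refine ⟨{μ v}, {ν v}, fun _ => ⟨?_, ?_, ?_, ?_, hv v⟩⟩
      · intro v' h
        simp [Finset.singleton_inj.1 h]
      · intro x y h h'
        have hx : x ∈ ({v} : Finset V) := by simp [h']
        have hy : y ∈ ({v} : Finset V) := by simp [h']
        rw [Finset.mem_singleton] at hx hy
        exact absurd (hx.trans hy.symm) h.ne
      · rintro _ rfl
        simp [hμ]
      · rintro _ rfl
        simp [hν]
    · obtain ⟨P, Q, hP, hQ, hP', hQ', hR⟩ := he v w h
      refine ⟨P, Q, fun _ => ⟨?_, ?_, hP', hQ', hR⟩⟩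
      · intro x hx
        have h1 : v ∈ ({x} : Finset V) := by simp [← hx]
        have h2 : w ∈ ({x} : Finset V) := by simp [← hx]
        rw [Finset.mem_singleton] at h1 h2
        exact absurd (h1.trans h2.symm) h.ne
      · intro x y hxy hs
        have hx : x ∈ ({v, w} : Finset V) := by simp [hs]
        have hy : y ∈ ({v, w} : Finset V) := by simp [hs]
        simp only [Finset.mem_insert, Finset.mem_singleton] at hx hy
        -- Walks were chosen once for the unordered pair, in one orientation; the opposite
        -- orientation uses the reversed walks.
        rcases hx with rfl | rfl <;> rcases hy with rfl | rfl
        · exact absurd rfl hxy.ne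
        · exact ⟨hP, hQ⟩
        · exact ⟨hP.symm, hQ.symm⟩
        · exact absurd rfl hxy.ne
  choose W W' hW using key
  refine ⟨W, W', ⟨?_, ?_, ?_⟩, ⟨?_, ?_, ?_⟩, fun s hs => (hW s hs).2.2.2.2⟩
  · exact fun v => ((hW _ (isSimplex_singleton v)).1 v rfl).1
  · exact fun v w h => ((hW _ (isSimplex_pair h)).2.1 v w h rfl).1
  · exact fun s hs => (hW s hs).2.2.1
  · exact fun v => ((hW _ (isSimplex_singleton v)).1 v rfl).2
  · exact fun v w h => ((hW _ (isSimplex_pair h)).2.1 v w h rfl).2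
  · exact fun s hs => (hW s hs).2.2.2.1

namespace Blowup

theorem a_mem (B : Blowup G H φ) (v : V) : B.a v ∈ B.part {v} := by
  simp [B.part_singleton]

theorem b_mem (B : Blowup G H φ) (v : V) : B.b v ∈ B.part {v} := by
  simp [B.part_singleton]

theorem map_a (B : Blowup G H φ) (v : V) : φ (B.a v) = {v} :=
  B.map_of_mem_singleton v _ (B.a_mem v)

theorem map_b (B : Blowup G H φ) (v : V) : φ (B.b v) = {v} :=
  B.map_of_mem_singleton v _ (B.b_mem v)

theorem eq_of_mem_singleton (B : Blowup G H φ) {v w : V} {x : V'} (h : x ∈ B.part {v})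
    (h' : x ∈ B.part {w}) : v = w := by
  simpa [B.map_of_mem_singleton v x h] using B.map_of_mem_singleton w x h'

theorem mem_pair_left (B : Blowup G H φ) {v w : V} (h : G.Adj v w) {x : V'}
    (hx : x ∈ B.part {v}) : x ∈ B.part {v, w} :=
  B.part_mono _ (isSimplex_pair h) v (by simp) hx

theorem mem_pair_right (B : Blowup G H φ) {v w : V} (h : G.Adj v w) {x : V'}
    (hx : x ∈ B.part {w}) : x ∈ B.part {v, w} :=
  B.part_mono _ (isSimplex_pair h) w (by simp) hx

theorem exists_isCarrier (B : Blowup G H φ) : ∃ μ W, IsCarrier G H φ μ W := by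
  refine ⟨B.a, B.part, B.a_mem, fun v w h => ?_, B.map_subset⟩
  -- Only connectedness of the part is needed; `B.b v` is a vertex to avoid that differs from both
  -- ends.
  refine (B.joins_avoiding v w h (B.b v) _ (B.mem_pair_left h (B.a_mem v)) _
    (B.mem_pair_right h (B.a_mem w)) (B.adj v).ne fun h' => ?_).mono Set.sdiff_subset
  exact h.ne (B.eq_of_mem_singleton (B.b_mem v) (h' ▸ B.a_mem w))

/-- There are two carriers that meet over the vertices only. -/
theorem exists_isCarrier_inter_subset (B : Blowup G H φ) :
    ∃ μ ν W W', IsCarrier G H φ μ W ∧ IsCarrier G H φ ν W' ∧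
      ∀ s t, IsSimplex G s → IsSimplex G t → ∀ x ∈ W s, x ∈ W' t → ∃ v, x ∈ B.part {v} := by
  have key := exists_isCarrier_pair (G := G) (H := H) (φ := φ) (μ := B.a)
    (ν := B.b) (R := fun s P Q => P ⊆ B.part s ∧ Q ⊆ B.part s ∧
      ∀ x ∈ P, x ∈ Q → ∃ v, x ∈ B.part {v})
    (fun v => ⟨by simp [B.a_mem], by simp [B.b_mem], by
      rintro _ rfl -
      exact ⟨v, B.a_mem v⟩⟩) B.map_a B.map_b
  obtain ⟨W, W', hW, hW', hR⟩ := key (by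
    intro v w h
    obtain ⟨P, hP, Q, hQ, hPQ, h' | h'⟩ := B.linked v w h
    · exact ⟨P, Q, h'.1, h'.2, fun x hx => B.map_subset _ (isSimplex_pair h) x (hP hx),
        fun x hx => B.map_subset _ (isSimplex_pair h) x (hQ hx), hP, hQ,
        fun x hx hx' => absurd hx' (Set.disjoint_left.1 hPQ hx)⟩
    · have ha := B.mem_pair_right h (B.a_mem w)
      have hb := B.mem_pair_right h (B.b_mem w)
      have hP' : insert (B.a w) P ⊆ B.part {v, w} := Set.insert_subset ha hP
      have hQ' : insert (B.b w) Q ⊆ B.part {v, w} := Set.insert_subset hb hQ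
      -- When the linkage is crossed, uncross it by traversing the edge over `w` at the end of both
      -- walks. The only new common vertices are its ends, which lie over `w`.
      refine ⟨insert (B.a w) P, insert (B.b w) Q,
        (h'.1.mono (by simp)).trans (.of_adj (B.adj w).symm (by simp [h'.1.right_mem]) (by simp)),
        (h'.2.mono (by simp)).trans (.of_adj (B.adj w) (by simp [h'.2.right_mem]) (by simp)),
        fun x hx => B.map_subset _ (isSimplex_pair h) x (hP' hx),
        fun x hx => B.map_subset _ (isSimplex_pair h) x (hQ' hx), hP', hQ', ?_⟩
      rintro x (rfl | hx) hx'
      · exact ⟨w, B.a_mem w⟩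
      rcases hx' with rfl | hx'
      · exact ⟨w, B.b_mem w⟩
      · exact absurd hx' (Set.disjoint_left.1 hPQ hx))
  refine ⟨B.a, B.b, W, W', hW, hW', fun s t hs ht x hx hx' => ?_⟩
  by_cases hst : s = t
  · subst hst
    exact (hR s hs).2.2 x hx hx'
  · obtain ⟨v, -, -, hv⟩ := B.mem_inter s t hs ht hst x ((hR s hs).1 hx) ((hR t ht).2.1 hx')
    exact ⟨v, hv⟩

/-- If `M` and `N` meet over the vertices of `G` only, then over `M` and `N` there are disjoint
carriers in the next blow-up. -/
theorem exists_isCarrier_disjoint [DecidableEq V'] (B : Blowup G H φ) (C : Blowup H J ψ)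
    {M N : Set V'}
    (hMN : ∀ x ∈ M, x ∈ N → ∃ v, x ∈ B.part {v}) :
    ∃ μ ν W W', IsCarrier H J ψ μ W ∧ IsCarrier H J ψ ν W' ∧
      ∀ s t, IsSimplex H s → IsSimplex H t → ↑s ⊆ M → ↑t ⊆ N → Disjoint (W s) (W' t) := by
  classical
  let parallel (m n : V') : Prop := ∃ P ⊆ C.part {m, n}, ∃ Q ⊆ C.part {m, n},
    Disjoint P Q ∧ Joins J P (C.a m) (C.a n) ∧ Joins J Q (C.b m) (C.b n)
  -- Exchange the two labels over `B.b v` exactly when no straight linkage exists over the edge from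
  -- `B.a v` to `B.b v`; the crossed linkage then becomes straight. The choices do not interfere,
  -- since these edges are disjoint for different `v` and labels over `B.a v` are never exchanged.
  let swapped (m : V') : Prop := ∃ v, m = B.b v ∧ ¬ parallel (B.a v) (B.b v)
  let μ (m : V') : V'' := if swapped m then C.b m else C.a m
  let ν (m : V') : V'' := if swapped m then C.a m else C.b m
  have hμν : ∀ m, μ m ≠ ν m := by
    intro m
    by_cases h : swapped m
    · simpa [μ, ν, h] using (C.adj m).ne'
    · simpa [μ, ν, h] using (C.adj m).ne
  have hpart : ∀ m, C.part {m} = {μ m, ν m} := by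
    intro m
    by_cases h : swapped m
    · simp [μ, ν, h, C.part_singleton, Set.pair_comm]
    · simp [μ, ν, h, C.part_singleton]
  have hμ : ∀ m, μ m ∈ C.part {m} := fun m => by simp [hpart]
  have hν : ∀ m, ν m ∈ C.part {m} := fun m => by simp [hpart]
  have hstraight : ∀ v, ∃ P ⊆ C.part {B.a v, B.b v}, ∃ Q ⊆ C.part {B.a v, B.b v},
      Disjoint P Q ∧ Joins J P (μ (B.a v)) (μ (B.b v)) ∧ Joins J Q (ν (B.a v)) (ν (B.b v)) := by
    intro v
    have ha : ¬ swapped (B.a v) := by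
      rintro ⟨w, hw, -⟩
      obtain rfl := B.eq_of_mem_singleton (B.a_mem v) (hw ▸ B.b_mem w)
      exact (B.adj v).ne hw
    by_cases hp : parallel (B.a v) (B.b v)
    · have hb : ¬ swapped (B.b v) := by
        rintro ⟨w, hw, hnot⟩
        obtain rfl := B.eq_of_mem_singleton (B.b_mem v) (hw ▸ B.b_mem w)
        exact hnot hp
      simpa [μ, ν, ha, hb] using hp
    · have hb : swapped (B.b v) := ⟨v, rfl, hp⟩
      obtain ⟨P, hP, Q, hQ, hPQ, h | h⟩ := C.linked _ _ (B.adj v)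
      · exact absurd ⟨P, hP, Q, hQ, hPQ, h.1, h.2⟩ hp
      · simpa only [μ, ν, ha, hb, if_true, if_false] using ⟨P, hP, Q, hQ, hPQ, h.1, h.2⟩
  -- The third clause of `R` handles two distinct simplices: their parts meet only over a common
  -- vertex `m`, where the first carrier may use only `μ m` and the second only `ν m` if `m` lies in
  -- both `M` and `N`.
  have key := exists_isCarrier_pair (G := H) (H := J) (φ := ψ) (μ := μ)
    (ν := ν) (R := fun s P Q => P ⊆ C.part s ∧ Q ⊆ C.part s ∧
      (∀ m ∈ s, m ∈ M → m ∈ N → ν m ∉ P ∧ μ m ∉ Q) ∧ (↑s ⊆ M → ↑s ⊆ N → Disjoint P Q))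
    (fun m => ⟨by simp [hμ], by simp [hν], by
      simp [hμν m, (hμν m).symm], by simp [hμν m]⟩)
    (fun m => C.map_of_mem_singleton m _ (hμ m)) (fun m => C.map_of_mem_singleton m _ (hν m))
  obtain ⟨W, W', hW, hW', hR⟩ := key (by
    intro m n hmn
    by_cases hD : (m ∈ M ∧ m ∈ N) ∧ n ∈ M ∧ n ∈ N
    · obtain ⟨v, hv⟩ := hMN m hD.1.1 hD.1.2
      obtain ⟨w, hw⟩ := hMN n hD.2.1 hD.2.2
      -- Both ends project to single vertices, and the images of adjacent vertices are nested, so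
      -- the two singletons coincide.
      have hvw : v = w := by
        have h1 := B.map_of_mem_singleton v m hv
        have h2 := B.map_of_mem_singleton w n hw
        have := B.quasi m n hmn
        rw [h1, h2] at this
        simpa [eq_comm] using this
      subst hvw
      obtain ⟨P, hP, Q, hQ, hPQ, hjP, hjQ⟩ : ∃ P ⊆ C.part {m, n}, ∃ Q ⊆ C.part {m, n},
          Disjoint P Q ∧ Joins J P (μ m) (μ n) ∧ Joins J Q (ν m) (ν n) := by
        rw [B.part_singleton] at hv hw
        rcases hv with rfl | rfl <;> rcases hw with rfl | rfl
        · exact absurd rfl hmn.ne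
        · exact hstraight v
        · obtain ⟨P, hP, Q, hQ, hPQ, hjP, hjQ⟩ := hstraight v
          rw [Finset.pair_comm] at hP hQ
          exact ⟨P, hP, Q, hQ, hPQ, hjP.symm, hjQ.symm⟩
        · exact absurd rfl hmn.ne
      refine ⟨P, Q, hjP, hjQ, fun x hx => C.map_subset _ (isSimplex_pair hmn) x (hP hx),
        fun x hx => C.map_subset _ (isSimplex_pair hmn) x (hQ hx), hP, hQ, ?_, fun _ _ => hPQ⟩
      simp only [Finset.mem_insert, Finset.mem_singleton]
      rintro _ (rfl | rfl) - -
      · exact ⟨Set.disjoint_right.1 hPQ hjQ.left_mem, Set.disjoint_left.1 hPQ hjP.left_mem⟩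
      · exact ⟨Set.disjoint_right.1 hPQ hjQ.right_mem, Set.disjoint_left.1 hPQ hjP.right_mem⟩
    -- At most one end is shared. Take `d` to be that end, or `n` if there is none, and route the
    -- two walks around `ν d` and `μ d` respectively; they may intersect each other.
    · obtain ⟨d, hd, hd'⟩ : ∃ d, (d = m ∨ d = n) ∧
          ∀ k, (k = m ∨ k = n) → k ∈ M → k ∈ N → k = d := by
        by_cases hm : m ∈ M ∧ m ∈ N
        · refine ⟨m, .inl rfl, ?_⟩
          rintro k (rfl | rfl) h h'
          · rfl
          · exact absurd ⟨hm, h, h'⟩ hD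
        · refine ⟨n, .inr rfl, ?_⟩
          rintro k (rfl | rfl) h h'
          · exact absurd ⟨h, h'⟩ hm
          · rfl
      have hne : ∀ k, (k = m ∨ k = n) → μ k ≠ ν d ∧ ν k ≠ μ d := by
        intro k _
        refine ⟨fun h => ?_, fun h => ?_⟩
        · obtain rfl := C.eq_of_mem_singleton (hμ k) (h ▸ hν d)
          exact hμν _ h
        · obtain rfl := C.eq_of_mem_singleton (hν k) (h ▸ hμ d)
          exact hμν _ h.symm
      refine ⟨C.part {m, n} \ {ν d}, C.part {m, n} \ {μ d},
        C.joins_avoiding m n hmn _ _ (C.mem_pair_left hmn (hμ m)) _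
          (C.mem_pair_right hmn (hμ n)) (hne m (.inl rfl)).1 (hne n (.inr rfl)).1,
        C.joins_avoiding m n hmn _ _ (C.mem_pair_left hmn (hν m)) _
          (C.mem_pair_right hmn (hν n)) (hne m (.inl rfl)).2 (hne n (.inr rfl)).2,
        fun x hx => C.map_subset _ (isSimplex_pair hmn) x hx.1,
        fun x hx => C.map_subset _ (isSimplex_pair hmn) x hx.1, Set.sdiff_subset, Set.sdiff_subset,
        ?_, ?_⟩
      · simp only [Finset.mem_insert, Finset.mem_singleton]
        intro k hk h h'
        obtain rfl := hd' k hk h h'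
        simp
      · intro h h'
        exact absurd ⟨⟨h (by simp), h' (by simp)⟩, h (by simp), h' (by simp)⟩ hD)
  refine ⟨μ, ν, W, W', hW, hW', fun s t hs ht hsM htN => ?_⟩
  by_cases hst : s = t
  · subst hst
    exact (hR s hs).2.2.2 hsM htN
  rw [Set.disjoint_left]
  intro x hx hx'
  obtain ⟨m, hms, hmt, hm⟩ :=
    C.mem_inter s t hs ht hst x ((hR s hs).1 hx) ((hR t ht).2.1 hx')
  rw [hpart] at hm
  rcases hm with rfl | rfl
  · exact ((hR t ht).2.2.1 m hmt (hsM hms) (htN hmt)).2 hx'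
  · exact ((hR s hs).2.2.1 m hms (hsM hms) (htN hmt)).1 hx

end Blowup

end Carriers

/-! ### Bonding maps as blow-ups -/

section SingleSimplex

variable {V : Type u} {G : SimpleGraph V}

theorem IsSingleVertex.exists_forall_eq (h : IsSingleVertex G) : ∃ x : V, ∀ z, z = x := by
  obtain ⟨e⟩ := h
  exact ⟨e.symm 0, fun z => e.injective (Subsingleton.elim _ _)⟩

theorem IsSingleEdge.exists_adj (h : IsSingleEdge G) :
    ∃ x y, G.Adj x y ∧ ∀ z, z = x ∨ z = y := by
  obtain ⟨e⟩ := h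
  refine ⟨e.symm 0, e.symm 1, e.symm.map_rel_iff.2 (by simp), fun z => ?_⟩
  obtain h | h : e z = 0 ∨ e z = 1 := by
    generalize e z = i
    fin_cases i <;> simp
  · exact .inl (by simp [← h])
  · exact .inr (by simp [← h])

end SingleSimplex

namespace ColoredEmbedding

variable {K L : ColoredGraph.{u}} (i : ColoredEmbedding K L)

theorem mem_verts_image {y : L.V} : y ∈ i.image.verts ↔ ∃ x, i.toCopy x = y := by
  simp [image, SimpleGraph.Copy.toSubgraph]

theorem apply_mem_verts (x : K.V) : i.toCopy x ∈ i.image.verts :=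
  i.mem_verts_image.2 ⟨x, rfl⟩

theorem adj_image {y z : L.V} :
    i.image.Adj y z ↔ ∃ x w, K.graph.Adj x w ∧ i.toCopy x = y ∧ i.toCopy w = z := by
  simp [image, SimpleGraph.Copy.toSubgraph, Relation.Map]

theorem map_adj {x w : K.V} (h : K.graph.Adj x w) : L.graph.Adj (i.toCopy x) (i.toCopy w) :=
  i.toCopy.toHom.map_adj h

theorem joins_image {W : Set K.V} {x y : K.V} (h : Joins K.graph W x y) :
    Joins L.graph (i.toCopy '' W) (i.toCopy x) (i.toCopy y) :=
  Joins.map h i.toCopy.toHom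

theorem exists_verts_eq_singleton (h : IsSingleVertex K.graph) : ∃ x, i.image.verts = {x} := by
  obtain ⟨x, hx⟩ := h.exists_forall_eq
  refine ⟨i.toCopy x, Set.ext fun y => ?_⟩
  rw [mem_verts_image]
  constructor
  · rintro ⟨z, rfl⟩
    simp [hx z]
  · rintro rfl
    exact ⟨x, rfl⟩

theorem exists_verts_eq_pair (h : IsSingleEdge K.graph) :
    ∃ x y, L.graph.Adj x y ∧ i.image.verts = {x, y} := by
  obtain ⟨x, y, hxy, hall⟩ := h.exists_adj
  refine ⟨i.toCopy x, i.toCopy y, i.map_adj hxy, Set.ext fun z => ?_⟩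
  rw [mem_verts_image]
  constructor
  · rintro ⟨w, rfl⟩
    rcases hall w with rfl | rfl <;> simp
  · rintro (rfl | rfl)
    exacts [⟨x, rfl⟩, ⟨y, rfl⟩]

theorem adj_image_of_isSingleEdge (h : IsSingleEdge K.graph) {y z : L.V}
    (hy : y ∈ i.image.verts) (hz : z ∈ i.image.verts) (hne : y ≠ z) : i.image.Adj y z := by
  obtain ⟨x, x', hx, hall⟩ := h.exists_adj
  obtain ⟨y, rfl⟩ := i.mem_verts_image.1 hy
  obtain ⟨z, rfl⟩ := i.mem_verts_image.1 hz
  refine i.adj_image.2 ⟨y, z, ?_, rfl, rfl⟩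
  rcases hall y with rfl | rfl <;> rcases hall z with rfl | rfl
  exacts [absurd rfl hne, hx, hx.symm, absurd rfl hne]

end ColoredEmbedding

theorem GraphMap.toFun_nonempty {K L : ColoredGraph.{u}} (f : GraphMap K L) (x : K.V) :
    (f.toFun x).Nonempty := by
  obtain ⟨ψ, hψ, -⟩ | h := f.simplicial_or_quasiSimplicial
  · simp [hψ]
  · exact (h.1 x).1

namespace Decomposition

variable {D : MarkovDiagram.{u}} {K L : ColoredGraph.{u}} {f : GraphMap K L}
  (δ : Decomposition.{u, v} D f)

theorem map_subset_of_mem {a : δ.Γ.Vert} {x : K.V} (hx : x ∈ (δ.topChart a).image.verts) :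
    (↑(f.toFun x) : Set L.V) ⊆ (δ.bottomChart a).image.verts := by
  obtain ⟨x, rfl⟩ := (δ.topChart a).mem_verts_image.1 hx
  intro y hy
  rw [δ.comm] at hy
  obtain ⟨z, -, rfl⟩ := Finset.mem_map.1 (Finset.mem_coe.1 hy)
  exact (δ.bottomChart a).apply_mem_verts z

theorem exists_mem_top (x : K.V) : ∃ a, x ∈ (δ.topChart a).image.verts := by
  have h : x ∈ (⨆ a, (δ.topChart a).image).verts := by simp [δ.top_cover]
  simpa using h

theorem exists_top_adj {x y : K.V} (h : K.graph.Adj x y) :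
    ∃ a, (δ.topChart a).image.Adj x y := by
  have h : (⨆ a, (δ.topChart a).image).Adj x y := by simpa [δ.top_cover]
  simpa using h

theorem exists_bottom_adj {x y : L.V} (h : L.graph.Adj x y) :
    ∃ a, (δ.bottomChart a).image.Adj x y := by
  have h : (⨆ a, (δ.bottomChart a).image).Adj x y := by simpa [δ.bottom_cover]
  simpa using h

theorem exists_inter {a b : δ.Γ.Vert} {v : L.V} (ha : v ∈ (δ.bottomChart a).image.verts)
    (hb : v ∈ (δ.bottomChart b).image.verts) :
    ∃ c, (δ.topChart c).image = (δ.topChart a).image ⊓ (δ.topChart b).image ∧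
      (δ.bottomChart c).image.verts =
        (δ.bottomChart a).image.verts ∩ (δ.bottomChart b).image.verts := by
  obtain ⟨c, h, h'⟩ := δ.inter_closed a b fun h => by
    have hv : v ∈ ((δ.bottomChart a).image ⊓ (δ.bottomChart b).image).verts := ⟨ha, hb⟩
    simp [h] at hv
  exact ⟨c, h, by simp [h']⟩

theorem isVertexProduction_of_verts_eq (hD : D.IsElementary)
    {a : δ.Γ.Vert} {v : L.V}
    (h : (δ.bottomChart a).image.verts = {v}) : (δ.Γ.prod a).IsVertexProduction := by
  refine (hD _ (δ.Γ.prod_mem a)).resolve_right fun he => ?_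
  obtain ⟨x, y, hxy, h'⟩ := (δ.bottomChart a).exists_verts_eq_pair he
  rw [h] at h'
  have hx : x ∈ ({v} : Set L.V) := h' ▸ (by simp)
  have hy : y ∈ ({v} : Set L.V) := h' ▸ (by simp)
  exact hxy.ne (hx.trans hy.symm)

theorem exists_edge_chart (hD : D.IsElementary)
    {v w : L.V} (h : L.graph.Adj v w) :
    ∃ a, (δ.Γ.prod a).IsEdgeProduction ∧ (δ.bottomChart a).image.verts = {v, w} := by
  obtain ⟨a, ha⟩ := δ.exists_bottom_adj h
  have hv := (δ.bottomChart a).image.edge_vert ha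
  have hw := (δ.bottomChart a).image.edge_vert ha.symm
  refine ⟨a, (hD _ (δ.Γ.prod_mem a)).resolve_left fun hs => ?_, ?_⟩
  · obtain ⟨x, hx⟩ := (δ.bottomChart a).exists_verts_eq_singleton hs
    rw [hx] at hv hw
    exact h.ne (hv.trans hw.symm)
  · obtain hs | hs := hD _ (δ.Γ.prod_mem a)
    · obtain ⟨x, hx⟩ := (δ.bottomChart a).exists_verts_eq_singleton hs
      rw [hx] at hv hw
      exact absurd (hv.trans hw.symm) h.ne
    · obtain ⟨x, y, hxy, h'⟩ := (δ.bottomChart a).exists_verts_eq_pair hs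
      rw [h'] at hv hw ⊢
      rcases hv with rfl | rfl <;> rcases hw with rfl | rfl
      · exact absurd rfl h.ne
      · rfl
      · exact Set.pair_comm _ _
      · exact absurd rfl h.ne

theorem exists_top_eq_pair (hD : D.IsElementary)
    (hvertex : ∀ P ∈ D.productions, P.IsVertexProduction → IsSingleEdge P.top.graph)
    {c : δ.Γ.Vert} {v : L.V}
    (h : (δ.bottomChart c).image.verts = {v}) :
    ∃ x y, K.graph.Adj x y ∧ (δ.topChart c).image.verts = {x, y} :=
  (δ.topChart c).exists_verts_eq_pair
    (hvertex _ (δ.Γ.prod_mem c) (δ.isVertexProduction_of_verts_eq hD h))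

/-- Intersecting the two charts gives a chart over `v` alone, whose top is a single edge contained
in the single edge `c`. The two edges therefore agree, so the top of `c` lies in that of `a`. In
particular, all charts over `v` have the same top. -/
theorem top_le_of_mem (hD : D.IsElementary)
    (hvertex : ∀ P ∈ D.productions, P.IsVertexProduction → IsSingleEdge P.top.graph)
    {c a : δ.Γ.Vert} {v : L.V}
    (hc : (δ.bottomChart c).image.verts = {v}) (ha : v ∈ (δ.bottomChart a).image.verts) :
    (δ.topChart c).image ≤ (δ.topChart a).image := by
  obtain ⟨d, hd, hd'⟩ := δ.exists_inter (a := c) (b := a) (by simp [hc]) ha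
  have hdv : (δ.bottomChart d).image.verts = {v} := by
    rw [hd', hc]
    simpa using ha
  obtain ⟨x, y, hxy, h⟩ := δ.exists_top_eq_pair hD hvertex hc
  obtain ⟨x', y', hxy', h'⟩ := δ.exists_top_eq_pair hD hvertex hdv
  have hcd : (δ.topChart c).image.verts ⊆ (δ.topChart d).image.verts := by
    have hsub : (δ.topChart d).image.verts ⊆ (δ.topChart c).image.verts := by
      rw [hd]
      exact Set.inter_subset_left
    rw [h, h'] at hsub ⊢
    have h1 := hsub (Set.mem_insert x' _)
    have h2 := hsub (Set.mem_insert_of_mem x' rfl)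
    rcases h1 with rfl | rfl <;> rcases h2 with rfl | rfl
    · exact absurd rfl hxy'.ne
    · rfl
    · rw [Set.pair_comm]
    · exact absurd rfl hxy'.ne
  have hle : (δ.topChart c).image ≤ (δ.topChart d).image := by
    refine ⟨hcd, fun p q hpq => ?_⟩
    exact (δ.topChart d).adj_image_of_isSingleEdge
      (hvertex _ (δ.Γ.prod_mem d) (δ.isVertexProduction_of_verts_eq hD hdv))
      (hcd ((δ.topChart c).image.edge_vert hpq)) (hcd ((δ.topChart c).image.edge_vert hpq.symm))
      hpq.ne
  exact hle.trans (hd ▸ inf_le_right)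

theorem exists_adj (δ : Decomposition.{u, v} D f) (hD : D.IsElementary)
    (hvertex : ∀ P ∈ D.productions, P.IsVertexProduction → IsSingleEdge P.top.graph)
    (hedge : ∀ P ∈ D.productions, P.IsEdgeProduction →
      P.top.graph.Connected ∧ IsBiconnected P.top.graph)
    (x : K.V) : ∃ y, K.graph.Adj x y := by
  obtain ⟨a, ha⟩ := δ.exists_mem_top x
  obtain h | h := hD _ (δ.Γ.prod_mem a)
  · obtain ⟨y, z, hyz, h'⟩ := (δ.topChart a).exists_verts_eq_pair (hvertex _ (δ.Γ.prod_mem a) h)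
    rw [h'] at ha
    rcases ha with rfl | rfl
    exacts [⟨z, hyz⟩, ⟨y, hyz.symm⟩]
  · obtain ⟨x, rfl⟩ := (δ.topChart a).mem_verts_image.1 ha
    obtain ⟨hc, hb⟩ := hedge _ (δ.Γ.prod_mem a) h
    obtain ⟨y, -, hy, -⟩ := exists_two_neighbors_of_biconnected hb hc x
    exact ⟨_, (δ.topChart a).map_adj hy⟩

/-- Since no vertex of the target is isolated, the top of a vertex chart lies in the top of some
edge chart. Thus every vertex of the source belongs to an embedded biconnected graph. -/
theorem exists_two_neighbors (δ : Decomposition.{u, v} D f) (hD : D.IsElementary)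
    (hvertex : ∀ P ∈ D.productions, P.IsVertexProduction → IsSingleEdge P.top.graph)
    (hedge : ∀ P ∈ D.productions, P.IsEdgeProduction →
      P.top.graph.Connected ∧ IsBiconnected P.top.graph)
    (hL : ∀ v, ∃ w, L.graph.Adj v w) (x : K.V) :
    ∃ y z, K.graph.Adj x y ∧ K.graph.Adj x z ∧ y ≠ z := by
  obtain ⟨a, h, ha⟩ : ∃ a, (δ.Γ.prod a).IsEdgeProduction ∧ x ∈ (δ.topChart a).image.verts := by
    obtain ⟨a, ha⟩ := δ.exists_mem_top x
    obtain h | h := hD _ (δ.Γ.prod_mem a)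
    · obtain ⟨v, hv⟩ := (δ.bottomChart a).exists_verts_eq_singleton h
      obtain ⟨w, hw⟩ := hL v
      obtain ⟨b, hb, hb'⟩ := δ.exists_edge_chart hD hw
      exact ⟨b, hb, (δ.top_le_of_mem hD hvertex hv (by simp [hb'])).1 ha⟩
    · exact ⟨a, h, ha⟩
  obtain ⟨x, rfl⟩ := (δ.topChart a).mem_verts_image.1 ha
  obtain ⟨hc, hb⟩ := hedge _ (δ.Γ.prod_mem a) h
  obtain ⟨y, z, hy, hz, hyz⟩ := exists_two_neighbors_of_biconnected hb hc x
  exact ⟨_, _, (δ.topChart a).map_adj hy, (δ.topChart a).map_adj hz,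
    fun h => hyz ((δ.topChart a).toCopy.injective h)⟩

/-- Closure under intersections produces the chart from two edges that meet in `v` only; this is
where two neighbours are needed. -/
theorem exists_vertex_chart (hD : D.IsElementary)
    {v w w' : L.V} (hw : L.graph.Adj v w) (hw' : L.graph.Adj v w')
    (hne : w ≠ w') : ∃ c, (δ.bottomChart c).image.verts = {v} := by
  obtain ⟨a, -, ha⟩ := δ.exists_edge_chart hD hw
  obtain ⟨b, -, hb⟩ := δ.exists_edge_chart hD hw'
  obtain ⟨c, -, hc⟩ := δ.exists_inter (a := a) (b := b) (v := v) (by simp [ha]) (by simp [hb])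
  refine ⟨c, ?_⟩
  rw [hc, ha, hb]
  ext y
  simp only [Set.mem_inter_iff, Set.mem_insert_iff, Set.mem_singleton_iff]
  grind

theorem exists_chart (hD : D.IsElementary)
    (hL : ∀ v, ∃ w w', L.graph.Adj v w ∧ L.graph.Adj v w' ∧ w ≠ w') {s : Finset L.V}
    (hs : IsSimplex L.graph s) : ∃ a, (δ.bottomChart a).image.verts = s := by
  classical
  obtain ⟨v, rfl⟩ | ⟨v, w, h, rfl⟩ := hs.eq_singleton_or_pair
  · obtain ⟨w, w', hw, hw', hne⟩ := hL v
    simpa using δ.exists_vertex_chart hD hw hw' hne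
  · obtain ⟨a, -, ha⟩ := δ.exists_edge_chart hD h
    exact ⟨a, by simpa using ha⟩

theorem isEdgeProduction_of_verts_eq (hD : D.IsElementary) {a : δ.Γ.Vert} {v w : L.V}
    (h : (δ.bottomChart a).image.verts = {v, w}) (hne : v ≠ w) :
    (δ.Γ.prod a).IsEdgeProduction := by
  refine (hD _ (δ.Γ.prod_mem a)).resolve_left fun hs => ?_
  obtain ⟨x, hx⟩ := (δ.bottomChart a).exists_verts_eq_singleton hs
  rw [hx] at h
  have hv : v ∈ ({x} : Set L.V) := h ▸ (by simp)
  have hw : w ∈ ({x} : Set L.V) := h ▸ (by simp)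
  exact hne (hv.trans hw.symm)

/-- The bonding map is quasi-simplicial. -/
theorem isQuasiSimplicial (hD : D.IsElementary)
    (hquasi : ∀ P ∈ D.productions, P.IsEdgeProduction → P.map.IsQuasiSimplicial)
    (δ : Decomposition.{u, v} D f) : IsQuasiSimplicialVertexMap K L f.toFun := by
  classical
  refine ⟨fun x => ?_, fun x y hxy => ?_⟩
  · obtain ⟨ψ, hψ, -⟩ | h := f.simplicial_or_quasiSimplicial
    · rw [hψ]
      exact isSimplex_singleton _
    · exact h.1 x
  · obtain ⟨a, ha⟩ := δ.exists_top_adj hxy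
    obtain h | h := hD _ (δ.Γ.prod_mem a)
    · obtain ⟨v, hv⟩ := (δ.bottomChart a).exists_verts_eq_singleton h
      have hx := δ.map_subset_of_mem ((δ.topChart a).image.edge_vert ha)
      have hy := δ.map_subset_of_mem ((δ.topChart a).image.edge_vert ha.symm)
      obtain ⟨w, hw⟩ := f.toFun_nonempty y
      rw [hv] at hx hy
      obtain rfl := hy hw
      refine .inl fun z hz => ?_
      obtain rfl := hx hz
      exact hw
    · obtain ⟨x, y, hxy', rfl, rfl⟩ := (δ.topChart a).adj_image.1 ha
      rw [δ.comm, δ.comm, Finset.map_subset_map, Finset.map_subset_map]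
      exact (hquasi _ (δ.Γ.prod_mem a) h).2 x y hxy'

/-- The bonding map describes a blow-up, if every vertex has at least two neighbours. -/
theorem nonempty_blowup (δ : Decomposition.{u, v} D f) [DecidableEq L.V] (hD : D.IsElementary)
    (hvertex : ∀ P ∈ D.productions, P.IsVertexProduction → IsSingleEdge P.top.graph)
    (hedge : ∀ P ∈ D.productions, P.IsEdgeProduction →
      P.top.graph.Connected ∧ IsBiconnected P.top.graph)
    (hquasi : ∀ P ∈ D.productions, P.IsEdgeProduction → P.map.IsQuasiSimplicial)
    (hL : ∀ v, ∃ w w', L.graph.Adj v w ∧ L.graph.Adj v w' ∧ w ≠ w') :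
    Nonempty (Blowup L.graph K.graph f.toFun) := by
  have hchart : ∀ s : Finset L.V, ∃ T : Set K.V, IsSimplex L.graph s →
      ∃ a, (δ.bottomChart a).image.verts = s ∧ T = (δ.topChart a).image.verts := by
    intro s
    by_cases hs : IsSimplex L.graph s
    · obtain ⟨a, ha⟩ := δ.exists_chart hD hL hs
      exact ⟨_, fun _ => ⟨a, ha, rfl⟩⟩
    · exact ⟨∅, fun h => absurd h hs⟩
  choose part hpart using hchart
  have hpair : ∀ v, ∃ x y, K.graph.Adj x y ∧ part {v} = {x, y} := by
    intro v
    obtain ⟨c, hc, hc'⟩ := hpart {v} (isSimplex_singleton v)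
    rw [hc']
    exact δ.exists_top_eq_pair hD hvertex (by simpa using hc)
  choose a b hab hpart' using hpair
  have hsub : ∀ s, IsSimplex L.graph s → ∀ x ∈ part s, f.toFun x ⊆ s := by
    intro s hs x hx
    obtain ⟨c, hc, hc'⟩ := hpart s hs
    rw [hc'] at hx
    exact Finset.coe_subset.1 (hc ▸ δ.map_subset_of_mem hx)
  have hsingle : ∀ c v, (δ.bottomChart c).image.verts = {v} →
      part {v} = (δ.topChart c).image.verts := by
    intro c v hv
    obtain ⟨d, hd, hd'⟩ := hpart {v} (isSimplex_singleton v)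
    rw [Finset.coe_singleton] at hd
    rw [hd']
    exact Set.Subset.antisymm (δ.top_le_of_mem hD hvertex hd (by simp [hv])).1
      (δ.top_le_of_mem hD hvertex hv (by simp [hd])).1
  have hedgechart : ∀ v w, L.graph.Adj v w → ∃ e, part {v, w} = (δ.topChart e).image.verts ∧
      (δ.Γ.prod e).top.graph.Connected ∧ IsBiconnected (δ.Γ.prod e).top.graph ∧
      (δ.topChart e).image.Adj (a v) (b v) ∧ (δ.topChart e).image.Adj (a w) (b w) := by
    intro v w h
    obtain ⟨e, he, he'⟩ := hpart {v, w} (isSimplex_pair h)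
    rw [Finset.coe_pair] at he
    have hadj : ∀ u ∈ (δ.bottomChart e).image.verts, (δ.topChart e).image.Adj (a u) (b u) := by
      intro u hu
      obtain ⟨c, hc, hc'⟩ := hpart {u} (isSimplex_singleton u)
      rw [Finset.coe_singleton] at hc
      rw [hpart'] at hc'
      exact (δ.top_le_of_mem hD hvertex hc hu).2 <| (δ.topChart c).adj_image_of_isSingleEdge
        (hvertex _ (δ.Γ.prod_mem c) (δ.isVertexProduction_of_verts_eq hD hc))
        (by simp [← hc']) (by simp [← hc']) (hab u).ne
    obtain ⟨h1, h2⟩ := hedge _ (δ.Γ.prod_mem e) (δ.isEdgeProduction_of_verts_eq hD he h.ne)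
    exact ⟨e, he', h1, h2, hadj v (by simp [he]), hadj w (by simp [he])⟩
  refine ⟨⟨part, a, b, hab, hpart', ?_, hsub, ?_, ?_, ?_, ?_,
    (isQuasiSimplicial hD hquasi δ).2⟩⟩
  · intro v x hx
    exact (Finset.subset_singleton_iff.1 (hsub _ (isSimplex_singleton v) x hx)).resolve_left
      (f.toFun_nonempty x).ne_empty
  · intro s hs v hv
    obtain ⟨c, hc, hc'⟩ := hpart {v} (isSimplex_singleton v)
    obtain ⟨d, hd, hd'⟩ := hpart s hs
    rw [hc', hd']
    exact (δ.top_le_of_mem hD hvertex (by simpa using hc) (by simpa [hd] using hv)).1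
  · intro s t hs ht hst x hxs hxt
    obtain ⟨v, hv⟩ := f.toFun_nonempty x
    have hvs := hsub s hs x hxs hv
    have hvt := hsub t ht x hxt hv
    obtain ⟨c, hc, hc'⟩ := hpart s hs
    obtain ⟨d, hd, hd'⟩ := hpart t ht
    obtain ⟨e, he, he'⟩ := δ.exists_inter (a := c) (b := d) (v := v) (by simpa [hc] using hvs)
      (by simpa [hd] using hvt)
    refine ⟨v, hvs, hvt, ?_⟩
    -- Distinct simplices of a graph share at most one vertex, so the intersection chart is a vertex
    -- chart.
    have hinter : s ∩ t = {v} := by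
      have hcard : (s ∩ t).card ≤ 1 := by
        by_contra! hlt
        have h1 := Finset.eq_of_subset_of_card_le (Finset.inter_subset_left (s₁ := s) (s₂ := t))
          (hs.2.1.trans hlt)
        have h2 := Finset.eq_of_subset_of_card_le (Finset.inter_subset_right (s₁ := s) (s₂ := t))
          (ht.2.1.trans hlt)
        exact hst (h1.symm.trans h2)
      exact (Finset.eq_of_subset_of_card_le
        (Finset.singleton_subset_iff.2 (Finset.mem_inter.2 ⟨hvs, hvt⟩)) (by simpa using hcard)).symm
    rw [hsingle e v (by rw [he', hc, hd, ← Finset.coe_inter, hinter, Finset.coe_singleton]), he]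
    exact ⟨hc' ▸ hxs, hd' ▸ hxt⟩
  · intro v w h
    obtain ⟨e, he, hconn, hbic, hv, hw⟩ := hedgechart v w h
    rw [he]
    obtain ⟨x, x', hx, hxa, hxb⟩ := (δ.topChart e).adj_image.1 hv
    obtain ⟨y, y', hy, hya, hyb⟩ := (δ.topChart e).adj_image.1 hw
    rw [← hxa, ← hxb, ← hya, ← hyb]
    have himage : ∀ P : Set (δ.Γ.prod e).top.V,
        (δ.topChart e).toCopy '' P ⊆ (δ.topChart e).image.verts := by
      rintro P _ ⟨z, -, rfl⟩
      exact (δ.topChart e).apply_mem_verts z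
    obtain ⟨P, Q, hPQ, h'⟩ := linked_of_biconnected hbic hconn hx hy
    refine ⟨_, himage P, _, himage Q, ?_, h'.imp ?_ ?_⟩
    · exact (Set.disjoint_image_iff (δ.topChart e).toCopy.injective).2 hPQ
    · exact fun h => ⟨(δ.topChart e).joins_image h.1, (δ.topChart e).joins_image h.2⟩
    · exact fun h => ⟨(δ.topChart e).joins_image h.1, (δ.topChart e).joins_image h.2⟩
  · intro v w h z x hx y hy hxz hyz
    obtain ⟨e, he, hconn, hbic, -, -⟩ := hedgechart v w h
    rw [he] at hx hy ⊢
    obtain ⟨x, rfl⟩ := (δ.topChart e).mem_verts_image.1 hx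
    obtain ⟨y, rfl⟩ := (δ.topChart e).mem_verts_image.1 hy
    by_cases hz : z ∈ (δ.topChart e).image.verts
    · obtain ⟨z, rfl⟩ := (δ.topChart e).mem_verts_image.1 hz
      refine ((δ.topChart e).joins_image (joins_compl_of_biconnected hbic
        (fun h => hxz (congrArg _ h)) (fun h => hyz (congrArg _ h)) :
          Joins _ {z}ᶜ x y)).mono ?_
      rintro _ ⟨u, hu, rfl⟩
      exact ⟨(δ.topChart e).apply_mem_verts u, fun h => hu ((δ.topChart e).toCopy.injective h)⟩
    · obtain ⟨p⟩ := hconn.preconnected x y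
      refine ((δ.topChart e).joins_image (⟨p, fun _ _ => trivial⟩ : Joins _ Set.univ x y)).mono ?_
      rintro _ ⟨u, -, rfl⟩
      exact ⟨(δ.topChart e).apply_mem_verts u, fun h => hz (h ▸ (δ.topChart e).apply_mem_verts u)⟩

end Decomposition

/-! ### Realizations and carriers -/

section Realization

variable {V : Type*} {G : SimpleGraph V}

theorem IsSimplex.subset {s t : Finset V} (hs : IsSimplex G s) (ht : t.Nonempty) (h : t ⊆ s) :
    IsSimplex G t :=
  ⟨ht, (Finset.card_le_card h).trans hs.2.1, fun a ha b hb => hs.2.2 a (h ha) b (h hb)⟩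

variable [Fintype V]

open scoped Classical in
/-- The set of nonzero coordinates. -/
noncomputable def supp (t : V → ℝ) : Finset V :=
  Finset.univ.filter fun x => t x ≠ 0

@[simp]
theorem mem_supp {t : V → ℝ} {x : V} : x ∈ supp t ↔ t x ≠ 0 := by
  simp [supp]

theorem supp_nonempty {t : V → ℝ} (h : ∑ x, t x = 1) : (supp t).Nonempty := by
  by_contra! h'
  have h0 : ∀ x, t x = 0 := fun x => by
    by_contra hx
    have : x ∈ supp t := mem_supp.2 hx
    simp [h'] at this
  simp [h0] at h

/-- The support is the smallest face carrying a point, so it serves as a canonical witness for the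
simplex. -/
theorem mem_realization_iff {t : V → ℝ} :
    t ∈ realization G ↔ (∀ x, 0 ≤ t x) ∧ ∑ x, t x = 1 ∧ IsSimplex G (supp t) := by
  refine and_congr_right fun _ => and_congr_right fun h1 => ⟨?_, fun h => ⟨_, h, by simp⟩⟩
  rintro ⟨s, hs, h⟩
  refine hs.subset (supp_nonempty h1) fun x hx => ?_
  by_contra hxs
  exact mem_supp.1 hx (h x hxs)

theorem isSimplex_supp {t : V → ℝ} (h : t ∈ realization G) : IsSimplex G (supp t) :=
  (mem_realization_iff.1 h).2.2

theorem isClosed_realization_face (s : Finset V) :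
    IsClosed {t : V → ℝ | (∀ x, 0 ≤ t x) ∧ ∑ x, t x = 1 ∧ ∀ x, x ∉ s → t x = 0} := by
  have h1 : IsClosed {t : V → ℝ | ∀ x, 0 ≤ t x} := by
    simp only [Set.ofPred_forall]
    exact isClosed_iInter fun x => isClosed_le continuous_const (continuous_apply x)
  have h2 : IsClosed {t : V → ℝ | ∑ x, t x = 1} := isClosed_eq (by fun_prop) continuous_const
  have h3 : IsClosed {t : V → ℝ | ∀ x, x ∉ s → t x = 0} := by
    simp only [Set.ofPred_forall]
    exact isClosed_iInter fun x => isClosed_iInter fun _ =>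
      isClosed_eq (continuous_apply x) continuous_const
  exact h1.inter (h2.inter h3)

theorem realization_eq_iUnion : realization G = ⋃ s : {s : Finset V // IsSimplex G s},
    {t : V → ℝ | (∀ x, 0 ≤ t x) ∧ ∑ x, t x = 1 ∧ ∀ x, x ∉ s.1 → t x = 0} := by
  ext t
  simp only [realization, Set.mem_ofPred_eq, Set.mem_iUnion, Subtype.exists, exists_prop]
  grind

theorem isClosed_realization : IsClosed (realization G) := by
  rw [realization_eq_iUnion]
  exact isClosed_iUnion_of_finite fun s => isClosed_realization_face s.1

theorem realization_subset_Icc : realization G ⊆ Set.Icc 0 1 := by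
  rintro t ⟨h0, h1, -⟩
  refine ⟨h0, fun x => ?_⟩
  rw [Pi.one_apply, ← h1]
  exact Finset.single_le_sum (fun y _ => h0 y) (Finset.mem_univ x)

theorem isCompact_realization : IsCompact (realization G) :=
  isCompact_Icc.of_isClosed_subset isClosed_realization realization_subset_Icc

theorem dist_le_one {t t' : V → ℝ} (h : t ∈ realization G) (h' : t' ∈ realization G) :
    dist t t' ≤ 1 := by
  refine (dist_pi_le_iff zero_le_one).2 fun x => ?_
  have h1 := realization_subset_Icc h
  have h2 := realization_subset_Icc h'
  have := h1.1 x
  have := h1.2 x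
  have := h2.1 x
  have := h2.2 x
  simp only [Pi.zero_apply, Pi.one_apply] at *
  rw [Real.dist_eq, abs_le]
  constructor <;> linarith

/-- The points of the realization of `G` that are supported in `W`. -/
def face (G : SimpleGraph V) (W : Set V) : Set (V → ℝ) :=
  {t | t ∈ realization G ∧ ∀ x, t x ≠ 0 → x ∈ W}

variable [DecidableEq V]

theorem single_mem_face {W : Set V} {x : V} (hx : x ∈ W) : Pi.single x 1 ∈ face G W := by
  refine ⟨⟨fun y => ?_, by simp, {x}, isSimplex_singleton x, fun y hy => ?_⟩, fun y hy => ?_⟩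
  · by_cases h : y = x
    · subst h
      simp
    · simp [h]
  · simp [Finset.mem_singleton.not.1 hy]
  · by_cases h : y = x
    · exact h ▸ hx
    · simp [h] at hy

theorem segment_subset_face {W : Set V} {x y : V} (h : G.Adj x y) (hx : x ∈ W) (hy : y ∈ W) :
    segment ℝ (Pi.single x 1 : V → ℝ) (Pi.single y 1) ⊆ face G W := by
  rintro _ ⟨a, b, ha, hb, hab, rfl⟩
  have hout : ∀ z, z ≠ x → z ≠ y →
      (a • (Pi.single x 1 : V → ℝ) + b • (Pi.single y 1 : V → ℝ)) z = 0 := by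
    intro z h1 h2
    simp [h1, h2]
  refine ⟨⟨fun z => ?_, ?_, {x, y}, isSimplex_pair h, fun z hz => ?_⟩, fun z hz => ?_⟩
  · have h1 : 0 ≤ (Pi.single x 1 : V → ℝ) z := (single_mem_face (G := G) (Set.mem_univ x)).1.1 z
    have h2 : 0 ≤ (Pi.single y 1 : V → ℝ) z := (single_mem_face (G := G) (Set.mem_univ y)).1.1 z
    simp only [Pi.add_apply, Pi.smul_apply, smul_eq_mul]
    positivity
  · simp [Finset.sum_add_distrib, ← Finset.mul_sum, hab]
  · simp only [Finset.mem_insert, Finset.mem_singleton, not_or] at hz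
    exact hout z hz.1 hz.2
  · by_cases h1 : z = x
    · exact h1 ▸ hx
    by_cases h2 : z = y
    · exact h2 ▸ hy
    exact absurd (hout z h1 h2) hz

theorem Joins.joinedIn {W : Set V} {x y : V} (h : Joins G W x y) :
    JoinedIn (face G W) (Pi.single x 1) (Pi.single y 1) := by
  obtain ⟨p, hp⟩ := h
  induction p with
  | nil => exact JoinedIn.refl (single_mem_face (hp _ (by simp)))
  | cons hadj p ih =>
    exact (JoinedIn.of_segment_subset (segment_subset_face hadj (hp _ (by simp))
      (hp _ (by simp)))).trans (ih fun z hz => hp z (by simp [hz]))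

theorem eq_single_of_supp_eq {t : V → ℝ} (h : ∑ x, t x = 1) {v : V} (hv : supp t = {v}) :
    t = Pi.single v 1 := by
  have h0 : ∀ x, x ≠ v → t x = 0 := fun x hx => by
    by_contra h'
    rw [← ne_eq, ← mem_supp, hv, Finset.mem_singleton] at h'
    exact hx h'
  rw [Finset.sum_eq_single v (fun x _ hx => h0 x hx) (by simp)] at h
  ext x
  by_cases hx : x = v
  · subst hx
    simp [h]
  · simp [hx, h0 x hx]

end Realization

/-- On an edge, one barycentric coordinate parametrizes a path in the carrier. Clamping it to the
unit interval makes the map continuous on the whole function space, so restriction to closed faces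
is immediate. -/
theorem IsCarrier.exists_continuous_of_isSimplex {V V' : Type*} [Fintype V'] [DecidableEq V]
    [DecidableEq V'] {G : SimpleGraph V} {H : SimpleGraph V'} {φ : V' → Finset V} {μ : V → V'}
    {W : Finset V → Set V'} (hW : IsCarrier G H φ μ W) {s : Finset V} (hs : IsSimplex G s) :
    ∃ γ : (V → ℝ) → (V' → ℝ), Continuous γ ∧
      (∀ v ∈ s, γ (Pi.single v 1) = Pi.single (μ v) 1) ∧ ∀ t, γ t ∈ face H (W s) := by
  obtain ⟨v, rfl⟩ | ⟨v, w, h, rfl⟩ := hs.eq_singleton_or_pair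
  · exact ⟨fun _ => Pi.single (μ v) 1, continuous_const, by simp,
      fun _ => single_mem_face (hW.mem v)⟩
  · have hj := (hW.joins v w h).joinedIn
    refine ⟨fun t => hj.somePath (Set.projIcc 0 1 zero_le_one (t w)),
      hj.somePath.continuous.comp (continuous_projIcc.comp (continuous_apply w)), ?_,
      fun t => hj.somePath_mem _⟩
    simp only [Finset.mem_insert, Finset.mem_singleton]
    rintro _ (rfl | rfl)
    · simp [h.ne']
    · simp

/-- A carrier is the carrier of a continuous map. -/
theorem IsCarrier.exists_continuousOn {V V' : Type*} [Fintype V] [Fintype V']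
    [DecidableEq V] {G : SimpleGraph V} {H : SimpleGraph V'} {φ : V' → Finset V} {μ : V → V'}
    {W : Finset V → Set V'} (hW : IsCarrier G H φ μ W) :
    ∃ γ : (V → ℝ) → (V' → ℝ), ContinuousOn γ (realization G) ∧
      ∀ t ∈ realization G, γ t ∈ face H (W (supp t)) := by
  classical
  have key : ∀ s : Finset V, ∃ γ : (V → ℝ) → (V' → ℝ), IsSimplex G s → Continuous γ ∧
      (∀ v ∈ s, γ (Pi.single v 1) = Pi.single (μ v) 1) ∧ ∀ t, γ t ∈ face H (W s) := by
    intro s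
    by_cases hs : IsSimplex G s
    · obtain ⟨γ, h⟩ := hW.exists_continuous_of_isSimplex hs
      exact ⟨γ, fun _ => h⟩
    · exact ⟨0, fun h => absurd h hs⟩
  choose γ hγ using key
  refine ⟨fun t => γ (supp t) t, ?_, fun t ht => (hγ _ (isSimplex_supp ht)).2.2 t⟩
  rw [realization_eq_iUnion]
  refine (locallyFinite_of_finite _).continuousOn_iUnion
    (fun s => isClosed_realization_face s.1) fun s => ?_
  refine (hγ _ s.2).1.continuousOn.congr fun t ht => ?_
  obtain ⟨h0, h1, hts⟩ := ht
  have hsub : supp t ⊆ s.1 := fun x hx => by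
    by_contra hxs
    exact mem_supp.1 hx (hts x hxs)
  have hsimp := s.2.subset (supp_nonempty h1) hsub
  -- The map chosen on the support agrees with the one on the face `s`: at a vertex both take the
  -- value prescribed by `μ`, and a support with two elements is all of `s`.
  obtain ⟨v, hv⟩ | ⟨v, w, hvw, hv⟩ := hsimp.eq_singleton_or_pair
  · have ht := eq_single_of_supp_eq h1 hv
    have hvs : v ∈ s.1 := hsub (by simp [hv])
    have h1 := (hγ _ hsimp).2.1 v (by simp [hv])
    have h2 := (hγ _ s.2).2.1 v hvs
    rw [← ht] at h1 h2
    exact h1.trans h2.symm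
  · have hcard : s.1.card ≤ (supp t).card := by
      rw [hv, Finset.card_pair hvw.ne]
      exact s.2.2.1
    simp only [Finset.eq_of_subset_of_card_le hsub hcard]

/-! ### The maps between the realizations -/

section Realize

theorem barycenter_nonneg {V : Type*} (s : Finset V) (x : V) : 0 ≤ barycenter s x :=
  Set.indicator_nonneg (fun _ _ => by positivity) x

theorem barycenter_ne_zero {V : Type*} {s : Finset V} {x : V} (h : barycenter s x ≠ 0) : x ∈ s := by
  simpa using Set.mem_of_indicator_ne_zero h

theorem sum_barycenter {V : Type*} [Fintype V] {s : Finset V} (hs : s.Nonempty) :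
    ∑ x, barycenter s x = 1 := by
  classical
  have : (s.card : ℝ) ≠ 0 := by simpa using hs.ne_empty
  simp [barycenter, Set.indicator_apply, this]

theorem abs_barycenter_sub_le {V : Type*} {G : SimpleGraph V} {s t : Finset V}
    (hs : IsSimplex G s) (ht : IsSimplex G t) (h : s ⊆ t) (x : V) :
    |barycenter s x - barycenter t x| ≤ 1 / 2 := by
  have h0 := hs.1.card_pos
  have hle := Finset.card_le_card h
  have h2 := ht.2.1
  obtain hc | ⟨hc, hc'⟩ : t.card ≤ s.card ∨ s.card = 1 ∧ t.card = 2 := by omega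
  · rw [Finset.eq_of_subset_of_card_le h hc]
    norm_num
  · by_cases hxs : x ∈ s
    · have hxt := h hxs
      simp [barycenter, hxs, hxt, hc, hc']
      norm_num
    · by_cases hxt : x ∈ t
      · simp [barycenter, hxs, hxt, hc']
      · simp [barycenter, hxs, hxt]

variable {K L : ColoredGraph.{u}} [Fintype K.V] (f : GraphMap K L)

theorem GraphMap.realize_apply (t : K.V → ℝ) (v : L.V) :
    f.realize t v = ∑ x, t x * barycenter (f.toFun x) v := by
  simp [GraphMap.realize]

theorem GraphMap.continuous_realize : Continuous f.realize := by
  unfold GraphMap.realize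
  fun_prop

variable {f}

theorem GraphMap.exists_of_realize_ne_zero {t : K.V → ℝ} {v : L.V} (h : f.realize t v ≠ 0) :
    ∃ x, t x ≠ 0 ∧ v ∈ f.toFun x := by
  rw [GraphMap.realize_apply] at h
  obtain ⟨x, -, hx⟩ := Finset.exists_ne_zero_of_sum_ne_zero h
  exact ⟨x, left_ne_zero_of_mul hx, barycenter_ne_zero (right_ne_zero_of_mul hx)⟩

theorem GraphMap.realize_mem [Fintype L.V] (hf : IsQuasiSimplicialVertexMap K L f.toFun)
    {t : K.V → ℝ} (ht : t ∈ realization K.graph) : f.realize t ∈ realization L.graph := by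
  classical
  refine ⟨fun v => ?_, ?_, ?_⟩
  · rw [GraphMap.realize_apply]
    exact Finset.sum_nonneg fun x _ => mul_nonneg (ht.1 x) (barycenter_nonneg _ _)
  · simp only [GraphMap.realize_apply]
    rw [Finset.sum_comm]
    simp only [← Finset.mul_sum, sum_barycenter (hf.1 _).1, mul_one]
    exact ht.2.1
  -- The values at the vertices of the support form a chain; the largest one is a simplex carrying
  -- the image.
  · obtain ⟨x, hx, hmax⟩ : ∃ x, t x ≠ 0 ∧ ∀ y, t y ≠ 0 → f.toFun y ⊆ f.toFun x := by
      obtain ⟨x, hx⟩ | ⟨x, y, hxy, hs⟩ := (isSimplex_supp ht).eq_singleton_or_pair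
      · refine ⟨x, mem_supp.1 (by simp [hx]), fun y hy => ?_⟩
        have : y ∈ supp t := mem_supp.2 hy
        rw [hx, Finset.mem_singleton] at this
        rw [this]
      · have hall : ∀ z, t z ≠ 0 → z = x ∨ z = y := fun z hz => by
          have : z ∈ supp t := mem_supp.2 hz
          simpa [hs] using this
        obtain h | h := hf.2 x y hxy
        · refine ⟨y, mem_supp.1 (by simp [hs]), fun z hz => ?_⟩
          rcases hall z hz with rfl | rfl
          exacts [h, subset_rfl]
        · refine ⟨x, mem_supp.1 (by simp [hs]), fun z hz => ?_⟩
          rcases hall z hz with rfl | rfl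
          exacts [subset_rfl, h]
    refine ⟨f.toFun x, hf.1 x, fun v hv => ?_⟩
    by_contra h
    obtain ⟨y, hy, hvy⟩ := exists_of_realize_ne_zero h
    exact hv (hmax y hy hvy)

/-- On each simplex, a quasi-simplicial map is a contraction by the factor `1 / 2`. -/
theorem GraphMap.dist_realize_le [Fintype L.V] (hf : IsQuasiSimplicialVertexMap K L f.toFun)
    {t t' : K.V → ℝ} (ht : t ∈ realization K.graph) (ht' : t' ∈ realization K.graph)
    {s : Finset K.V} (hs : IsSimplex K.graph s) (hts : supp t ⊆ s) (hts' : supp t' ⊆ s) :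
    dist (f.realize t) (f.realize t') ≤ 1 / 2 * dist t t' := by
  classical
  have hz : ∀ x, x ∉ s → t x = 0 ∧ t' x = 0 := fun x hx =>
    ⟨by_contra fun h => hx (hts (mem_supp.2 h)), by_contra fun h => hx (hts' (mem_supp.2 h))⟩
  have hsum : ∀ g : K.V → ℝ, (∑ x, t x * g x = ∑ x ∈ s, t x * g x) ∧
      ∑ x, t' x * g x = ∑ x ∈ s, t' x * g x := fun g =>
    ⟨(Finset.sum_subset (Finset.subset_univ s) fun x _ hx => by simp [(hz x hx).1]).symm,
      (Finset.sum_subset (Finset.subset_univ s) fun x _ hx => by simp [(hz x hx).2]).symm⟩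
  have h1 := ht.2.1
  have h1' := ht'.2.1
  have h2 := hsum fun _ => 1
  simp only [mul_one] at h2
  rw [h2.1] at h1
  rw [h2.2] at h1'
  refine (dist_pi_le_iff (by positivity)).2 fun v => ?_
  rw [Real.dist_eq, realize_apply, realize_apply, (hsum _).1, (hsum _).2]
  obtain ⟨x, rfl⟩ | ⟨x, y, hxy, rfl⟩ := hs.eq_singleton_or_pair
  · simp only [Finset.sum_singleton] at h1 h1' ⊢
    rw [h1, h1', sub_self, abs_zero]
    positivity
  · rw [Finset.sum_pair hxy.ne] at h1 h1' ⊢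
    rw [Finset.sum_pair hxy.ne]
    have hb : |barycenter (f.toFun x) v - barycenter (f.toFun y) v| ≤ 1 / 2 := by
      obtain h | h := hf.2 x y hxy
      · exact abs_barycenter_sub_le (hf.1 x) (hf.1 y) h v
      · rw [abs_sub_comm]
        exact abs_barycenter_sub_le (hf.1 y) (hf.1 x) h v
    have hd : |t x - t' x| ≤ dist t t' := by
      rw [← Real.dist_eq]
      exact dist_le_pi_dist t t' x
    -- The coordinates on the edge sum to `1`, so those at `y` can be eliminated; the difference
    -- then factors, and barycentres of nested simplices supply the factor `1 / 2`.
    have heq : t x * barycenter (f.toFun x) v + t y * barycenter (f.toFun y) v -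
        (t' x * barycenter (f.toFun x) v + t' y * barycenter (f.toFun y) v) =
        (barycenter (f.toFun x) v - barycenter (f.toFun y) v) * (t x - t' x) := by
      rw [eq_sub_of_add_eq' h1, eq_sub_of_add_eq' h1']
      ring
    rw [heq, abs_mul]
    exact mul_le_mul hb hd (abs_nonneg _) (by norm_num)

end Realize

/-! ### Threads and limits of approximate lifts -/

namespace MarkovSequence

open Filter Topology

variable {D : MarkovDiagram.{u}} (S : MarkovSequence.{u, v} D) [∀ i, Fintype (S.K i).V]

/-- The images of a point of the `k`-th stage in the earlier stages. -/
noncomputable def thread : ∀ k, ((S.K k).V → ℝ) → ∀ i, (S.K i).V → ℝ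
  -- Stages after the `k`-th get the meaningless value `0`; only indices up to `k` are used.
  | 0, y => Function.update 0 0 y
  | k + 1, y => Function.update (thread k ((S.p k).realize y)) (k + 1) y

@[simp]
theorem thread_self (k : ℕ) (y : (S.K k).V → ℝ) : S.thread k y k = y := by
  cases k <;> simp [thread]

theorem thread_succ {k i : ℕ} (hi : i ≤ k) (y : (S.K (k + 1)).V → ℝ) :
    S.thread (k + 1) y i = S.thread k ((S.p k).realize y) i := by
  rw [thread, Function.update_of_ne (by omega)]

theorem realize_thread {k i : ℕ} (hi : i < k) (y : (S.K k).V → ℝ) :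
    (S.p i).realize (S.thread k y (i + 1)) = S.thread k y i := by
  induction k with
  | zero => omega
  | succ k ih =>
    rw [S.thread_succ (by omega : i ≤ k)]
    obtain rfl | h : i = k ∨ i < k := by omega
    · simp
    · rw [S.thread_succ (by omega : i + 1 ≤ k), ih h]

theorem continuous_thread {k i : ℕ} (hi : i ≤ k) : Continuous fun y => S.thread k y i := by
  induction k with
  | zero =>
    obtain rfl : i = 0 := by omega
    simpa using continuous_id'
  | succ k ih =>
    obtain rfl | h : i = k + 1 ∨ i ≤ k := by omega
    · simpa using continuous_id'
    · simp only [S.thread_succ h]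
      exact (ih h).comp (S.p k).continuous_realize

theorem thread_of_limit (x : S.Limit) {k i : ℕ} (hi : i ≤ k) :
    S.thread k (x.1 k) i = x.1 i := by
  induction k with
  | zero =>
    obtain rfl : i = 0 := by omega
    simp
  | succ k ih =>
    obtain rfl | h : i = k + 1 ∨ i ≤ k := by omega
    · simp
    · rw [S.thread_succ h, x.2.2, ih h]

variable {S} in
theorem thread_mem (hq : ∀ i, IsQuasiSimplicialVertexMap _ _ (S.p i).toFun) {k i : ℕ}
    (hi : i ≤ k) {y : (S.K k).V → ℝ} (hy : y ∈ realization (S.K k).graph) :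
    S.thread k y i ∈ realization (S.K i).graph := by
  induction k with
  | zero =>
    obtain rfl : i = 0 := by omega
    simpa using hy
  | succ k ih =>
    obtain rfl | h : i = k + 1 ∨ i ≤ k := by omega
    · simpa using hy
    · rw [S.thread_succ h]
      exact ih h (GraphMap.realize_mem (hq k) hy)

variable {S} in
-- Coordinates are nonnegative, so nothing cancels under `realize` and inclusion of supports
-- persists. Both images thus stay in a common simplex, and each bonding map contributes a factor `1
-- / 2`.
theorem dist_thread_le (hq : ∀ i, IsQuasiSimplicialVertexMap _ _ (S.p i).toFun) {k i : ℕ}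
    (hi : i ≤ k) {y y' : (S.K k).V → ℝ} (hy : y ∈ realization (S.K k).graph)
    (hy' : y' ∈ realization (S.K k).graph) (h : supp y ⊆ supp y') :
    dist (S.thread k y i) (S.thread k y' i) ≤ (1 / 2) ^ (k - i) * dist y y' := by
  induction k with
  | zero =>
    obtain rfl : i = 0 := by omega
    simp
  | succ k ih =>
    obtain rfl | hik : i = k + 1 ∨ i ≤ k := by omega
    · simp
    · rw [S.thread_succ hik, S.thread_succ hik]
      have hd := GraphMap.dist_realize_le (hq k) hy hy' (isSimplex_supp hy') h subset_rfl
      refine (ih hik (GraphMap.realize_mem (hq k) hy) (GraphMap.realize_mem (hq k) hy') ?_).trans ?_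
      · intro v hv
        obtain ⟨x, hx, hvx⟩ := GraphMap.exists_of_realize_ne_zero (mem_supp.1 hv)
        have hx' : y' x ≠ 0 := mem_supp.1 (h (mem_supp.2 hx))
        rw [mem_supp, GraphMap.realize_apply]
        refine (Finset.sum_pos' (fun z _ => mul_nonneg (hy'.1 z) (barycenter_nonneg _ _))
          ⟨x, Finset.mem_univ x, mul_pos ((hy'.1 x).lt_of_ne' hx') ?_⟩).ne'
        have := ((hq k).1 x).1.card_pos
        simp [barycenter, hvx]
        exact ⟨v, hvx⟩
      · rw [show k + 1 - i = (k - i) + 1 by omega, pow_succ, mul_assoc]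
        exact mul_le_mul_of_nonneg_left hd (by positivity)

variable {S} in
/-- A sequence of approximate lifts of a map converges to a map into the limit, with control over
the supports. -/
theorem exists_limit_map {T : Type*} [TopologicalSpace T]
    (hq : ∀ i, IsQuasiSimplicialVertexMap _ _ (S.p i).toFun) {n : ℕ}
    {g : ∀ k, T → (S.K k).V → ℝ} (hg : ∀ k ≥ n, Continuous (g k))
    (hmem : ∀ k ≥ n, ∀ t, g k t ∈ realization (S.K k).graph)
    (hsupp : ∀ k ≥ n, ∀ t, ∀ x ∈ supp (g (k + 1) t), (S.p k).toFun x ⊆ supp (g k t)) :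
    ∃ F : C(T, S.Limit), ∀ k ≥ n, ∀ t, supp ((F t).1 k) ⊆ supp (g k t) := by
  have hp : ∀ k ≥ n, ∀ t, ∀ y, supp y ⊆ supp (g (k + 1) t) →
      supp ((S.p k).realize y) ⊆ supp (g k t) := by
    intro k hk t y hy v hv
    obtain ⟨x, hx, hvx⟩ := GraphMap.exists_of_realize_ne_zero (mem_supp.1 hv)
    exact hsupp k hk t x (hy (mem_supp.2 hx)) hvx
  -- The image of `g (k + 1) t` in stage `k` lies in the simplex spanned by the support of `g k t`,
  -- so the two are at distance at most `1` and approach each other geometrically in earlier stages.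
  have hstep : ∀ k ≥ n, ∀ i ≤ k, ∀ t,
      dist (S.thread k (g k t) i) (S.thread (k + 1) (g (k + 1) t) i) ≤ (1 / 2) ^ (k - i) := by
    intro k hk i hi t
    have hm := GraphMap.realize_mem (hq k) (hmem (k + 1) (by omega) t)
    rw [S.thread_succ hi, dist_comm]
    refine (dist_thread_le hq hi hm (hmem k hk t) (hp k hk t _ subset_rfl)).trans ?_
    exact mul_le_of_le_one_right (by positivity) (dist_le_one hm (hmem k hk t))
  -- Starting at `max i n` ensures both that stage `i` is reached by the threads and that the lifts
  -- are controlled.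
  have hstep' : ∀ i t j, dist (S.thread (max i n + j) (g (max i n + j) t) i)
      (S.thread (max i n + (j + 1)) (g (max i n + (j + 1)) t) i) ≤ 1 * (1 / 2) ^ j := by
    intro i t j
    rw [one_mul]
    refine (hstep (max i n + j) (by omega) i (by omega) t).trans ?_
    exact pow_le_pow_of_le_one (by norm_num) (by norm_num) (by omega)
  have hlim : ∀ i t, ∃ z, Tendsto (fun j => S.thread (max i n + j) (g (max i n + j) t) i)
      atTop (𝓝 z) := fun i t => cauchySeq_tendsto_of_complete
    (cauchySeq_of_le_geometric _ _ (by norm_num) (hstep' i t))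
  choose F hF using fun t i => hlim i t
  have hF' : ∀ t i, Tendsto (fun k => S.thread k (g k t) i) atTop (𝓝 (F t i)) := fun t i =>
    (tendsto_add_atTop_iff_nat (max i n)).1 ((hF t i).congr fun j => by rw [add_comm])
  have hFr : ∀ t i, F t i ∈ realization (S.K i).graph := fun t i =>
    isClosed_realization.mem_of_tendsto (hF' t i) <| by
      filter_upwards [eventually_ge_atTop (max i n)] with k hk
      exact thread_mem hq (by omega) (hmem k (by omega) t)
  have hFp : ∀ t i, (S.p i).realize (F t (i + 1)) = F t i := fun t i =>
    tendsto_nhds_unique (((S.p i).continuous_realize.tendsto _).comp (hF' t (i + 1)))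
      ((hF' t i).congr' <| by
        filter_upwards [eventually_gt_atTop i] with k hk
        exact (S.realize_thread hk _).symm)
  have hFc : ∀ i, Continuous fun t => F t i := by
    intro i
    have hunif : TendstoUniformly (fun j t => S.thread (max i n + j) (g (max i n + j) t) i)
        (fun t => F t i) atTop := by
      rw [Metric.tendstoUniformly_iff]
      intro ε hε
      have h0 : Tendsto (fun j : ℕ => 1 * (1 / 2 : ℝ) ^ j / (1 - 1 / 2)) atTop (𝓝 0) := by
        have := ((tendsto_pow_atTop_nhds_zero_of_lt_one (r := (1 / 2 : ℝ)) (by norm_num)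
          (by norm_num)).const_mul 1).div_const (1 - 1 / 2)
        simpa using this
      filter_upwards [h0.eventually_lt_const hε] with j hj t
      rw [dist_comm]
      exact (dist_le_of_le_geometric_of_tendsto _ _ (by norm_num) (hstep' i t) (hF t i) j).trans_lt
        hj
    refine hunif.continuous (Frequently.of_forall fun j => ?_)
    exact (S.continuous_thread (by omega)).comp (hg _ (by omega))
  refine ⟨⟨fun t => ⟨F t, hFr t, hFp t⟩, Continuous.subtype_mk (continuous_pi hFc) _⟩, ?_⟩
  intro k hk t x hx
  have hts : ∀ j, ∀ y, supp y ⊆ supp (g (k + j) t) →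
      supp (S.thread (k + j) y k) ⊆ supp (g k t) := by
    intro j
    induction j with
    | zero =>
      intro y hy
      simpa using hy
    | succ j ih =>
      intro y hy
      have := ih _ (hp (k + j) (by omega) t y hy)
      rwa [← S.thread_succ (by omega)] at this
  by_contra hx'
  -- A coordinate outside the support of `g k t` vanishes for all approximations from later stages,
  -- hence in the limit.
  refine mem_supp.1 hx (tendsto_nhds_unique ((tendsto_pi_nhds.1 (hF' t k)) x) ?_)
  refine tendsto_const_nhds.congr' ?_
  filter_upwards [eventually_ge_atTop k] with m hm
  obtain ⟨j, rfl⟩ := Nat.exists_eq_add_of_le hm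
  by_contra h
  exact hx' (hts j _ subset_rfl (mem_supp.2 (Ne.symm h)))

variable {S} in
/-- Two points of the limit in a common simplex of the `n`-th stage are close in the earlier
stages. -/
theorem dist_le_of_supp_subset (hq : ∀ i, IsQuasiSimplicialVertexMap _ _ (S.p i).toFun)
    {x y : S.Limit} {i n : ℕ} (hi : i ≤ n) (h : supp (y.1 n) ⊆ supp (x.1 n)) :
    dist (x.1 i) (y.1 i) ≤ (1 / 2) ^ (n - i) := by
  rw [← S.thread_of_limit x hi, ← S.thread_of_limit y hi, dist_comm]
  refine (dist_thread_le hq hi (y.2.1 n) (x.2.1 n) h).trans ?_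
  exact mul_le_of_le_one_right (by positivity) (dist_le_one (y.2.1 n) (x.2.1 n))

/-- An entourage of a product constrains only finitely many coordinates; take the largest such index
and the smallest tolerance. -/
theorem exists_forall_mem_of_mem_uniformity {U : Set (S.Limit × S.Limit)} (hU : U ∈ 𝓤 S.Limit) :
    ∃ n, ∃ ε > 0, ∀ x y : S.Limit, (∀ i ≤ n, dist (x.1 i) (y.1 i) < ε) → (x, y) ∈ U := by
  rw [show 𝓤 S.Limit = comap (fun q : S.Limit × S.Limit => (q.1.1, q.2.1))
    (𝓤 (∀ i, (S.K i).V → ℝ)) from uniformity_subtype, mem_comap] at hU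
  obtain ⟨U', hU', hsub⟩ := hU
  rw [Pi.uniformity, mem_iInf'] at hU'
  obtain ⟨I, hI, R, hR, -, hR', -⟩ := hU'
  have hε : ∀ i, ∃ ε > 0, ∀ x y : (S.K i).V → ℝ, dist x y < ε →
      ∀ p : (∀ i, (S.K i).V → ℝ) × (∀ i, (S.K i).V → ℝ), p.1 i = x → p.2 i = y → p ∈ R i := by
    intro i
    obtain ⟨t, ht, hts⟩ := mem_comap.1 (hR i)
    obtain ⟨ε, hε, h⟩ := Metric.mem_uniformity_dist.1 ht
    refine ⟨ε, hε, ?_⟩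
    rintro _ _ hxy p rfl rfl
    exact hts (h hxy)
  choose ε hε h using hε
  obtain ⟨n, hn⟩ := hI.bddAbove
  obtain ⟨δ, hδ, hδ'⟩ : ∃ δ > 0, ∀ i ≤ n, δ ≤ ε i := by
    refine ⟨(Finset.range (n + 1)).inf' Finset.nonempty_range_add_one ε, ?_, fun i hi => ?_⟩
    · exact (Finset.lt_inf'_iff _).2 fun i _ => hε i
    · exact Finset.inf'_le _ (by simpa using Nat.lt_succ_of_le hi)
  refine ⟨n, δ, hδ, fun x y hxy => hsub ?_⟩
  rw [Set.mem_preimage, hR']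
  refine Set.mem_iInter₂.2 fun i hi => ?_
  exact h i _ _ ((hxy i (hn hi)).trans_le (hδ' i (hn hi))) _ rfl rfl

instance : CompactSpace S.Limit := by
  have hcl : IsCompact {x : ∀ i, (S.K i).V → ℝ | (∀ i, x i ∈ realization (S.K i).graph) ∧
      ∀ i, (S.p i).realize (x (i + 1)) = x i} := by
    have h1 : IsCompact {x : ∀ i, (S.K i).V → ℝ | ∀ i, x i ∈ realization (S.K i).graph} :=
      isCompact_pi_infinite fun i => isCompact_realization
    have h2 : IsClosed {x : ∀ i, (S.K i).V → ℝ | ∀ i, (S.p i).realize (x (i + 1)) = x i} := by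
      simp only [Set.ofPred_forall]
      exact isClosed_iInter fun i => isClosed_eq
        ((S.p i).continuous_realize.comp (continuous_apply _)) (continuous_apply _)
    exact h1.inter_right h2
  exact isCompact_iff_compactSpace.1 hcl

/-! ### Disjoint arcs -/

variable {S} in
/-- Lifts of all stages from the `n`-th stage on turn a map into the limit into another one. -/
theorem exists_limit_map_of_lifts {T : Type*} [TopologicalSpace T]
    (hq : ∀ i, IsQuasiSimplicialVertexMap _ _ (S.p i).toFun) (n : ℕ) (f : C(T, S.Limit))
    {γ : ∀ k, ((S.K k).V → ℝ) → (S.K (k + 1)).V → ℝ}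
    (hγ : ∀ k ≥ n, ContinuousOn (γ k) (realization (S.K k).graph))
    (hγ' : ∀ k ≥ n, ∀ y ∈ realization (S.K k).graph, γ k y ∈ realization (S.K (k + 1)).graph ∧
      ∀ x ∈ supp (γ k y), (S.p k).toFun x ⊆ supp y) :
    ∃ F : C(T, S.Limit), ∀ t, supp ((F t).1 n) ⊆ supp ((f t).1 n) ∧
      supp ((F t).1 (n + 2)) ⊆ supp (γ (n + 1) (γ n ((f t).1 n))) := by
  -- Up to stage `n` these are the projections of `f`; afterwards each is the lift of the preceding
  -- one.
  let g : ∀ k, T → (S.K k).V → ℝ := fun k => Nat.rec (fun t => (f t).1 0)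
    (fun k h t => if n ≤ k then γ k (h t) else (f t).1 (k + 1)) k
  have hg : ∀ k t, g (k + 1) t = if n ≤ k then γ k (g k t) else (f t).1 (k + 1) := fun k t => rfl
  have hgn : ∀ k ≤ n, ∀ t, g k t = (f t).1 k := by
    rintro (_ | k) hk t
    · rfl
    · rw [hg, if_neg (by omega)]
  have hgs : ∀ k ≥ n, ∀ t, g (k + 1) t = γ k (g k t) := fun k hk t => by
    rw [hg, if_pos hk]
  have hmem : ∀ k ≥ n, ∀ t, g k t ∈ realization (S.K k).graph := by
    intro k hk t
    induction k, hk using Nat.le_induction with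
    | base =>
      rw [hgn n le_rfl]
      exact (f t).2.1 n
    | succ k hk ih =>
      rw [hgs k hk]
      exact (hγ' k hk _ ih).1
  have hcont : ∀ k ≥ n, Continuous (g k) := by
    intro k hk
    induction k, hk using Nat.le_induction with
    | base =>
      rw [show g n = fun t => (f t).1 n from funext (hgn n le_rfl)]
      exact (continuous_apply n).comp (continuous_subtype_val.comp f.continuous)
    | succ k hk ih =>
      rw [show g (k + 1) = fun t => γ k (g k t) from funext (hgs k hk)]
      exact (hγ k hk).comp_continuous ih (hmem k hk)
  obtain ⟨F, hF⟩ := exists_limit_map hq hcont hmem fun k hk t x hx => by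
    rw [hgs k hk] at hx
    exact (hγ' k hk _ (hmem k hk t)).2 x hx
  refine ⟨F, fun t => ⟨?_, ?_⟩⟩
  · have := hF n le_rfl t
    rwa [hgn n le_rfl] at this
  · have := hF (n + 2) (by omega) t
    rwa [hgs (n + 1) (by omega), hgs n le_rfl, hgn n le_rfl] at this

end MarkovSequence

/-- A lift of the realization of `G` to that of `H`. -/
structure IsLift {V V' : Type*} [Fintype V] [Fintype V'] (G : SimpleGraph V) (H : SimpleGraph V')
    (φ : V' → Finset V) (γ : (V → ℝ) → V' → ℝ) : Prop where
  continuousOn : ContinuousOn γ (realization G)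
  mem : ∀ y ∈ realization G, γ y ∈ realization H
  map_subset : ∀ y ∈ realization G, ∀ x ∈ supp (γ y), φ x ⊆ supp y

section Lifts

variable {V V' V'' : Type*} [Fintype V] [Fintype V'] [Fintype V''] [DecidableEq V]
  {G : SimpleGraph V} {H : SimpleGraph V'} {J : SimpleGraph V''} {φ : V' → Finset V}
  {ψ : V'' → Finset V'}

theorem IsCarrier.exists_isLift {μ : V → V'} {W : Finset V → Set V'} (hW : IsCarrier G H φ μ W) :
    ∃ γ, IsLift G H φ γ ∧ ∀ y ∈ realization G, ↑(supp (γ y)) ⊆ W (supp y) := by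
  obtain ⟨γ, hγ, h⟩ := hW.exists_continuousOn
  refine ⟨γ, ⟨hγ, fun y hy => (h y hy).1, fun y hy x hx => ?_⟩, fun y hy x hx => ?_⟩
  · exact hW.map_subset _ (isSimplex_supp hy) x ((h y hy).2 x (mem_supp.1 hx))
  · exact (h y hy).2 x (mem_supp.1 hx)

theorem Blowup.exists_isLift (B : Blowup G H φ) : ∃ γ, IsLift G H φ γ := by
  obtain ⟨μ, W, hW⟩ := B.exists_isCarrier
  obtain ⟨γ, hγ, -⟩ := hW.exists_isLift
  exact ⟨γ, hγ⟩

/-- Two consecutive blow-ups admit two pairs of lifts with disjoint images. -/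
theorem Blowup.exists_isLift_disjoint [DecidableEq V'] (B : Blowup G H φ) (C : Blowup H J ψ) :
    ∃ γ γ' η η', IsLift G H φ γ ∧ IsLift G H φ γ' ∧ IsLift H J ψ η ∧ IsLift H J ψ η' ∧
      ∀ y ∈ realization G, ∀ y' ∈ realization G,
        Disjoint (supp (η (γ y))) (supp (η' (γ' y'))) := by
  obtain ⟨μ, ν, W, W', hW, hW', hWW'⟩ := B.exists_isCarrier_inter_subset
  let M : Set V' := {x | ∃ s, IsSimplex G s ∧ x ∈ W s}
  let N : Set V' := {x | ∃ s, IsSimplex G s ∧ x ∈ W' s}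
  obtain ⟨_, _, X, X', hX, hX', hXX'⟩ := B.exists_isCarrier_disjoint C (M := M) (N := N) <| by
    rintro x ⟨s, hs, hx⟩ ⟨t, ht, hx'⟩
    exact hWW' s t hs ht x hx hx'
  obtain ⟨γ, hγ, hγW⟩ := hW.exists_isLift
  obtain ⟨γ', hγ', hγW'⟩ := hW'.exists_isLift
  obtain ⟨η, hη, hηX⟩ := hX.exists_isLift
  obtain ⟨η', hη', hηX'⟩ := hX'.exists_isLift
  refine ⟨γ, γ', η, η', hγ, hγ', hη, hη', fun y hy y' hy' => ?_⟩
  have h1 := hγ.mem y hy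
  have h2 := hγ'.mem y' hy'
  rw [← Finset.disjoint_coe]
  refine (hXX' _ _ (isSimplex_supp h1) (isSimplex_supp h2) ?_ ?_).mono (hηX _ h1) (hηX' _ h2)
  · exact fun x hx => ⟨_, isSimplex_supp hy, hγW y hy hx⟩
  · exact fun x hx => ⟨_, isSimplex_supp hy', hγW' y' hy' hx⟩

end Lifts

/-- The special pairs of lifts are used only at stages `n` and `n + 1`; any lifts do later, since
supports at stage `n + 2` can only shrink in the limit. -/
theorem MarkovSequence.exists_disjoint_maps {D : MarkovDiagram.{u}} {S : MarkovSequence.{u, v} D}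
    [∀ i, Fintype (S.K i).V] [∀ i, DecidableEq (S.K i).V] {T : Type*} [TopologicalSpace T]
    (hq : ∀ i, IsQuasiSimplicialVertexMap _ _ (S.p i).toFun) {n : ℕ}
    (hB : ∀ k ≥ n, Nonempty (Blowup (S.K k).graph (S.K (k + 1)).graph (S.p k).toFun))
    (f f' : C(T, S.Limit)) :
    ∃ F F' : C(T, S.Limit), (∀ t, supp ((F t).1 n) ⊆ supp ((f t).1 n)) ∧
      (∀ t, supp ((F' t).1 n) ⊆ supp ((f' t).1 n)) ∧ Disjoint (Set.range F) (Set.range F') := by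
  have hlift : ∀ k, ∃ γ, k ≥ n → IsLift (S.K k).graph (S.K (k + 1)).graph (S.p k).toFun γ := by
    intro k
    by_cases hk : k ≥ n
    · obtain ⟨B⟩ := hB k hk
      obtain ⟨γ, hγ⟩ := B.exists_isLift
      exact ⟨γ, fun _ => hγ⟩
    · exact ⟨0, fun h => absurd h hk⟩
  choose σ hσ using hlift
  obtain ⟨B⟩ := hB n le_rfl
  obtain ⟨C⟩ := hB (n + 1) (by omega)
  obtain ⟨γ, γ', η, η', hγ, hγ', hη, hη', hdisj⟩ := B.exists_isLift_disjoint C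
  have key : ∀ {γ η}, IsLift (S.K n).graph (S.K (n + 1)).graph (S.p n).toFun γ →
      IsLift (S.K (n + 1)).graph (S.K (n + 2)).graph (S.p (n + 1)).toFun η →
      ∀ f : C(T, S.Limit), ∃ F : C(T, S.Limit), ∀ t, supp ((F t).1 n) ⊆ supp ((f t).1 n) ∧
        supp ((F t).1 (n + 2)) ⊆ supp (η (γ ((f t).1 n))) := by
    intro γ η hγ hη f
    have hτ : ∀ k ≥ n, IsLift (S.K k).graph (S.K (k + 1)).graph (S.p k).toFun
        (Function.update (Function.update σ n γ) (n + 1) η k) := by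
      intro k hk
      by_cases h1 : k = n + 1
      · subst h1
        simpa using hη
      rw [Function.update_of_ne h1]
      by_cases h2 : k = n
      · subst h2
        simpa using hγ
      · rw [Function.update_of_ne h2]
        exact hσ k hk
    obtain ⟨F, hF⟩ := exists_limit_map_of_lifts hq n f (fun k hk => (hτ k hk).continuousOn)
      fun k hk y hy => ⟨(hτ k hk).mem y hy, (hτ k hk).map_subset y hy⟩
    refine ⟨F, fun t => ⟨(hF t).1, ?_⟩⟩
    have := (hF t).2
    rwa [Function.update_self, Function.update_of_ne (by omega), Function.update_self] at this
  obtain ⟨F, hF⟩ := key hγ hη f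
  obtain ⟨F', hF'⟩ := key hγ' hη' f'
  refine ⟨F, F', fun t => (hF t).1, fun t => (hF' t).1, Set.disjoint_left.2 ?_⟩
  rintro _ ⟨t, rfl⟩ ⟨t', ht'⟩
  -- A common point would have a nonempty support at stage `n + 2` contained in two disjoint sets.
  obtain ⟨x, hx⟩ := supp_nonempty ((F t).2.1 (n + 2)).2.1
  exact Finset.disjoint_left.1 (hdisj _ ((f t).2.1 n) _ ((f' t').2.1 n)) ((hF t).2 hx)
    ((hF' t').2 (ht' ▸ hx))

theorem disjointArcsProperty_of_blowup {D : MarkovDiagram.{u}} {S : MarkovSequence.{u, v} D}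
    [∀ i, Fintype (S.K i).V] [∀ i, DecidableEq (S.K i).V]
    (hq : ∀ i, IsQuasiSimplicialVertexMap _ _ (S.p i).toFun) {m : ℕ}
    (hB : ∀ k ≥ m, Nonempty (Blowup (S.K k).graph (S.K (k + 1)).graph (S.p k).toFun)) :
    DisjointArcsProperty S.Limit := by
  refine ⟨inferInstance, fun f U hU => ?_⟩
  obtain ⟨n, ε, hε, hn⟩ := S.exists_forall_mem_of_mem_uniformity hU
  obtain ⟨d, hd⟩ := exists_pow_lt_of_lt_one hε (show (1 / 2 : ℝ) < 1 by norm_num)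
  -- Here `m` reaches the blow-ups, `n` the last stage seen by the entourage, and `d` more stages
  -- shrink distances in it below `ε`.
  let k := m + n + d
  let arc (b : Bool) : C(unitInterval, S.Limit) := f.comp ⟨fun s => (s, b), by fun_prop⟩
  obtain ⟨F, F', hF, hF', hdisj⟩ := S.exists_disjoint_maps hq (n := k)
    (fun j hj => hB j (by omega)) (arc false) (arc true)
  have hclose : ∀ x y : S.Limit, supp (y.1 k) ⊆ supp (x.1 k) → (x, y) ∈ U := by
    refine fun x y h => hn x y fun i hi => ?_
    refine (MarkovSequence.dist_le_of_supp_subset hq (by omega) h).trans_lt (lt_of_le_of_lt ?_ hd)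
    exact pow_le_pow_of_le_one (by norm_num) (by norm_num) (by omega)
  refine ⟨⟨fun z => if z.2 = true then F' z.1 else F z.1, ?_⟩, ?_, ?_⟩
  · refine Continuous.if ?_ (by fun_prop) (by fun_prop)
    intro z hz
    have hclopen : IsClopen {z : unitInterval × Bool | z.2 = true} :=
      (isClopen_discrete {true}).preimage continuous_snd
    simp [hclopen.frontier_eq] at hz
  · rintro ⟨s, _ | _⟩
    · exact hclose _ _ (hF s)
    · exact hclose _ _ (hF' s)
  · simpa [Set.range, Function.comp_def] using hdisj

end Markov

theorem mainTheorem2 (D : Markov.MarkovDiagram.{u}) (hD : D.IsElementary)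
    (hvertex : ∀ P ∈ D.productions, P.IsVertexProduction → Markov.IsSingleEdge P.top.graph)
    (hedge : ∀ P ∈ D.productions, P.IsEdgeProduction →
      P.top.graph.Connected ∧ Markov.IsBiconnected P.top.graph)
    (hquasi : ∀ P ∈ D.productions, P.IsEdgeProduction → P.map.IsQuasiSimplicial)
    (S : Markov.MarkovSequence.{u, v} D) [∀ i, Fintype (S.K i).V] :
    Markov.DisjointArcsProperty S.Limit := by
  classical
  have hadj : ∀ i x, ∃ y, (S.K (i + 1)).graph.Adj x y := fun i x =>
    (S.decomposition i).exists_adj hD hvertex hedge x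
  have hadj' : ∀ i x, ∃ y z, (S.K (i + 2)).graph.Adj x y ∧ (S.K (i + 2)).graph.Adj x z ∧ y ≠ z :=
    fun i x => (S.decomposition (i + 1)).exists_two_neighbors hD hvertex hedge (hadj i) x
  -- One bonding map rules out isolated vertices in its source, and the next one gives two
  -- neighbours; so the target is good enough from index `2` on.
  refine Markov.disjointArcsProperty_of_blowup (m := 2)
    (fun i => (S.decomposition i).isQuasiSimplicial hD hquasi) fun k hk => ?_
  obtain ⟨i, rfl⟩ := Nat.exists_eq_add_of_le' hk
  exact (S.decomposition (i + 2)).nonempty_blowup hD hvertex hedge hquasi (hadj' i)
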